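/- Let $n\ge 1$, $X\in\{B,C\}$, and let $W=W(X_n)=\langle s_0,s_1,\dots,s_{n-1}\rangle$ be the Weyl group of type $B_n=C_n$ (the hyperoctahedral group), with $(s_0s_1)^4=1$, $(s_is_{i+1})^3=1$ for $i\ge1$, and $s_is_j=s_js_i$ for $|i-j|>1$; let $\ell$ be its length function. Let $R$ be a commutative ring with elements $\beta$ and $a_i,b_i,x_i$ ($i\ge1$) such that $1+\beta b_j$ is invertible for $1\le j\le n-1$ (for instance $\beta,a_i,b_i,x_i$ indeterminates over $\mathbb Z$, with the $1+\beta b_j$ inverted). Put $s\oplus t=s+t+\beta st$ and $\bar t=-t/(1+\beta t)$. Let $\mathrm{Id}_\beta(W)$ be the $R$-algebra with generators $u_0,\dots,u_{n-1}$ and relations $u_i^2=\beta u_i$ and $u_iu_ju_i\cdots=u_ju_iu_j\cdots$ ($m_{i,j}$ factors on each side, $m_{i,j}$ the order of $s_is_j$). For $w\in W$ put $u_w=u_{i_1}\cdots u_{i_\ell}$, where $w=s_{i_1}\cdots s_{i_\ell}$ is a reduced expression; the $u_w$ form an $R$-basis. Put $h_i(t)=1+tu_i$, $A_i(t)=h_{n-1}(t)h_{n-2}(t)\cdots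 h_i(t)$, $G_A(y)=A_1(y_1)A_2(y_2)\cdots A_{n-1}(y_{n-1})$, $$F^B(t)=h_{n-1}(t)\cdots h_1(t)\,h_0(t)\,h_1(t)\cdots h_{n-1}(t),\qquad F^C(t)=h_{n-1}(t)\cdots h_1(t)\,h_0(t)^2\,h_1(t)\cdots h_{n-1}(t).$$ The double Grothendieck polynomials $\mathcal G^X_{n,w}(a,b;x)$ are defined by the expansion $$G_A(\bar b)^{-1}\,F^X(x_1)F^X(x_2)\cdots F^X(x_n)\,G_A(a)=\sum_{w\in W}\mathcal G^X_{n,w}(a,b;x)\,u_w .$$ Let $$\Delta^X_n=(s_{n-1}\,|\,s_{n-2},s_{n-1}\,|\cdots|\,s_1,s_2,\dots,s_{n-1})\,(s_0,s_1,\dots,s_{n-1})^n=(d_1,\dots,d_N),\qquad N=\tfrac{n(n-1)}2+n^2 .$$ Give $d_k$ the coordinate $(k-\frac{m(m-1)}2,\,2n-m)$ if $\frac{m(m-1)}2<k\le\frac{m(m+1)}2$ with $1\le m\le n-1$, and the coordinate $(s+t,\,n-s)$ if $k=\frac{n(n-1)}2+sn+t$ with $0\le s\le n-1$, $1\le t\le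 n$. Put $p_i=x_{n+1-i}$ for $1\le i\le n$, $p_i=a_{i-n}$ for $i>n$, $q_j=x_j$ for $1\le j\le n$, $q_j=b_{j-n}$ for $j>n$. If $d_k$ has coordinate $(i,j)$, put $wt(d_k)=p_i\oplus q_j$, except that for $X=B$ and $i+j=n+1$ put $wt(d_k)=x_{n+1-i}$. For $w\in W$ let $\mathrm{RSub}(\Delta^X_n,w)$ be the set of subsequences $D=(d_{j_1},\dots,d_{j_\ell})$, $j_1<\dots<j_\ell$, $\ell=\ell(w)$, with $d_{j_1}\cdots d_{j_\ell}=w$ (subsequences at different positions are different). Let $\star$ be the Demazure product on $W$ ($v\star v'=z$ iff $u_vu_{v'}=\beta^{\ell(v)+\ell(v')-\ell(z)}u_z$, with $\beta$ an indeterminate), and let $B(D)$ be the set of those $d_j$ for which there is $p\in\{1,\dots,\ell\}$ with $j_p<j<j_{p+1}$ (where $j_{\ell+1}=N+1$) and $(d_{j_1}\cdots d_{j_p})\star d_j=d_{j_1}\cdots d_{j_p}$. Then for every $w\in W$ $$\mathcal G^X_{n,w}(a,b;x)=\sum_{D\in\mathrm{RSub}(\Delta^X_n,w)}\ \prod_{\Box\in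 D}wt(\Box)\ \prod_{\bigcirc\in B(D)}\bigl(1+\beta\,wt(\bigcirc)\bigr).$$ -/

import Mathlib

namespace TypeBC

/-! ### The Weyl group of type `B_n = C_n` -/

/-- The two types considered. They share the Weyl group but not the generating function. -/
inductive Kind where
  | B : Kind
  | C : Kind

/-- The Coxeter matrix of type `B_n = C_n` on the nodes `0, 1, ..., n - 1`, numbered so that the
double bond joins the nodes `0` and `1` (Mathlib numbers the nodes the other way round).
Its Coxeter group is the hyperoctahedral group. -/
def coxMatrix (n : ℕ) : CoxeterMatrix (Fin n) :=
  (CoxeterMatrix.B n).reindex Fin.revPerm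

/-- The entries: `(s_0 s_1)^4 = 1`, `(s_i s_{i+1})^3 = 1` for `i ≥ 1`, and commutation otherwise. -/
theorem coxMatrix_apply (n : ℕ) (i j : Fin n) :
    coxMatrix n i j =
      if i = j then 1
      else if ((i : ℕ) = 0 ∧ (j : ℕ) = 1) ∨ ((i : ℕ) = 1 ∧ (j : ℕ) = 0) then 4
      else if (i : ℕ) + 1 = j ∨ (j : ℕ) + 1 = i then 3 else 2 := by
  obtain ⟨i, hi⟩ := i
  obtain ⟨j, hj⟩ := j
  simp only [coxMatrix, CoxeterMatrix.reindex_apply, Fin.revPerm_symm, Fin.revPerm_apply,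
    CoxeterMatrix.B, Matrix.of_apply, Fin.rev_inj, Fin.val_rev, Fin.mk.injEq]
  split_ifs <;> first | rfl | (exfalso; omega)

/-! ### The idCoxeter algebra -/

section IdCoxeter

variable {B : Type*}

/-- The defining relations `u_i ^ 2 = β u_i` and
`u_i u_j u_i ⋯ = u_j u_i u_j ⋯` (`m_{i,j}` factors on both sides). -/
inductive IdRel (M : CoxeterMatrix B) {R : Type*} [CommRing R] (β : R) :
    FreeAlgebra R B → FreeAlgebra R B → Prop
  | sq (i : B) :
      IdRel M β (FreeAlgebra.ι R i * FreeAlgebra.ι R i) (β • FreeAlgebra.ι R i)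
  | braid (i j : B) :
      IdRel M β ((CoxeterSystem.braidWord M i j).map (FreeAlgebra.ι R)).prod
        ((CoxeterSystem.braidWord M j i).map (FreeAlgebra.ι R)).prod

/-- The idCoxeter algebra `Id_β(W)` with coefficients in `R`. -/
abbrev IdAlg (M : CoxeterMatrix B) {R : Type*} [CommRing R] (β : R) : Type _ :=
  RingQuot (IdRel M β)

variable (M : CoxeterMatrix B) {R : Type*} [CommRing R] (β : R)

/-- The generator `u_i`. -/
def u (i : B) : IdAlg M β := RingQuot.mkAlgHom R (IdRel M β) (FreeAlgebra.ι R i)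

theorem u_mul_self (i : B) : u M β i * u M β i = β • u M β i := by
  unfold u
  rw [← map_mul, ← map_smul]
  exact RingQuot.mkAlgHom_rel R (IdRel.sq i)

/-- `h_i(t) = 1 + t u_i`. -/
def h (i : B) (t : R) : IdAlg M β := 1 + t • u M β i

variable {M} {W : Type*} [Group W] (cs : CoxeterSystem M W)

/-- The element `u_w = u_{i_1} ⋯ u_{i_l}` for a reduced expression `w = s_{i_1} ⋯ s_{i_l}`. -/
noncomputable def uW (w : W) : IdAlg M β :=
  ((Classical.choose (cs.exists_isReduced w)).map (u M β)).prod

/-- `c` is a family of coefficients of `g` with respect to the `u_w`: `g = ∑ w, c w • u_w`. -/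
def IsExpansion (g : IdAlg M β) (c : W →₀ R) : Prop :=
  g = c.sum fun w r => r • uW β cs w

open Classical in
/-- The coefficient of `u_w` in `g`. -/
noncomputable def coeff (g : IdAlg M β) (w : W) : R :=
  if hg : ∃ c : W →₀ R, IsExpansion β cs g c then hg.choose w else 0

/-- The Demazure product, `w ⋆ v = z`: the identity `u_w u_v = β^{ℓ(w)+ℓ(v)-ℓ(z)} u_z` in the
idCoxeter algebra over `ℤ[β]`, `β` an indeterminate. -/
def IsDemazure (w v z : W) : Prop :=
  cs.length z ≤ cs.length w + cs.length v ∧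
    uW (Polynomial.X : Polynomial ℤ) cs w * uW (Polynomial.X : Polynomial ℤ) cs v =
      (Polynomial.X : Polynomial ℤ) ^ (cs.length w + cs.length v - cs.length z) •
        uW (Polynomial.X : Polynomial ℤ) cs z

/-! ### Reduced subwords and backward movable positions

A subsequence of `Δ = (d_0, ..., d_{N-1})` is given by its set of positions. -/

variable (Δ : List B)

/-- The word `(d_j : j ∈ J)`, in increasing order of the positions. -/
def subword (J : Finset (Fin Δ.length)) : List B :=
  ((List.finRange Δ.length).filter fun k => k ∈ J).map Δ.get

open Classical in
/-- `Rsub(Δ, w)`: the subsequences of `Δ` that are reduced expressions of `w`. -/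
noncomputable def Rsub (w : W) : Finset (Finset (Fin Δ.length)) :=
  Finset.univ.filter fun J => cs.wordProd (subword Δ J) = w ∧ J.card = cs.length w

open Classical in
/-- `B(D)`: the unselected positions `j` such that `v ⋆ d_j = v`, where `v` is the product of the
letters selected before `j` (for `v = 1` this never holds, so `j` comes after some selected
position). -/
noncomputable def backward (J : Finset (Fin Δ.length)) : Finset (Fin Δ.length) :=
  Finset.univ.filter fun j => j ∉ J ∧
    IsDemazure cs (cs.wordProd (subword Δ (J.filter fun k => k < j))) (cs.simple (Δ.get j))
      (cs.wordProd (subword Δ (J.filter fun k => k < j)))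

end IdCoxeter

/-! ### The generating function and the double Grothendieck polynomials

The variables `a_i`, `b_i`, `x_i` are indexed by `i ≥ 1`; the value at `0` is not used. -/

section Grothendieck

variable {R : Type*} [CommRing R] (β : R)

/-- `s ⊕ t = s + t + β s t`. -/
def oplus (s t : R) : R := s + t + β * s * t

/-- `⊖ t = - t / (1 + β t)`, used for `1 + β t` invertible. -/
noncomputable def ominus (t : R) : R := -t * Ring.inverse (1 + β * t)

variable (n : ℕ)

/-- `A_i(t) = h_{n-1}(t) h_{n-2}(t) ⋯ h_i(t)`. -/
def Adesc (i : ℕ) (t : R) : IdAlg (coxMatrix n) β :=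
  (((List.finRange n).filter fun k : Fin n => i ≤ (k : ℕ)).reverse.map
    fun k => h (coxMatrix n) β k t).prod

/-- `h_i(t) h_{i+1}(t) ⋯ h_{n-1}(t)`. -/
def Aasc (i : ℕ) (t : R) : IdAlg (coxMatrix n) β :=
  (((List.finRange n).filter fun k : Fin n => i ≤ (k : ℕ)).map fun k => h (coxMatrix n) β k t).prod

/-- `G_{A_{n-1}}(y_1, ..., y_{n-1}) = A_1(y_1) A_2(y_2) ⋯ A_{n-1}(y_{n-1})`. -/
def GA (y : ℕ → R) : IdAlg (coxMatrix n) β :=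
  ((List.range (n - 1)).map fun i => Adesc β n (i + 1) (y (i + 1))).prod

/-- `F_n^B(t) = h_{n-1}(t) ⋯ h_1(t) h_0(t) h_1(t) ⋯ h_{n-1}(t)` and
`F_n^C(t) = h_{n-1}(t) ⋯ h_1(t) h_0(t)^2 h_1(t) ⋯ h_{n-1}(t)`. -/
def F [NeZero n] (X : Kind) (t : R) : IdAlg (coxMatrix n) β :=
  match X with
  | Kind.B => Adesc β n 1 t * h (coxMatrix n) β 0 t * Aasc β n 1 t
  | Kind.C => Adesc β n 1 t * h (coxMatrix n) β 0 t ^ 2 * Aasc β n 1 t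

/-- `F_n^X(x_1) F_n^X(x_2) ⋯ F_n^X(x_n)`. -/
def Fprod [NeZero n] (X : Kind) (x : ℕ → R) : IdAlg (coxMatrix n) β :=
  ((List.range n).map fun i => F β n X (x (i + 1))).prod

/-- `G_n^X(a, b; x) = G_{A_{n-1}}(⊖ b_1, ..., ⊖ b_{n-1})⁻¹ F_n^X(x) G_{A_{n-1}}(a)`. -/
noncomputable def genFun [NeZero n] (X : Kind) (a b x : ℕ → R) : IdAlg (coxMatrix n) β :=
  Ring.inverse (GA β n fun j => ominus β (b j)) * Fprod β n X x * GA β n a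

/-- The double Grothendieck polynomial `𝒢^X_{n,w}(a, b; x)`, the coefficient of `u_w` in
`G_n^X(a, b; x)`. -/
noncomputable def groth [NeZero n] {W : Type*} [Group W] (cs : CoxeterSystem (coxMatrix n) W)
    (X : Kind) (a b x : ℕ → R) (w : W) : R :=
  coeff β cs (genFun β n X a b x) w

/-! The inverse in `genFun` is a true inverse. -/

theorem h_mul_h {B : Type*} (M : CoxeterMatrix B) (i : B) (s t : R) :
    h M β i s * h M β i t = h M β i (oplus β s t) := by
  simp only [h, oplus, mul_add, add_mul, one_mul, mul_one, smul_mul_smul_comm, u_mul_self,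
    add_smul, smul_smul]
  rw [show s * t * β = β * s * t by ring]
  abel

theorem isUnit_h_ominus {B : Type*} (M : CoxeterMatrix B) (i : B) (t : R)
    (ht : IsUnit (1 + β * t)) : IsUnit (h M β i (ominus β t)) := by
  have e : (1 + β * t) * Ring.inverse (1 + β * t) = 1 := Ring.mul_inverse_cancel _ ht
  have h0 : h M β i 0 = 1 := by simp [h]
  refine ⟨⟨h M β i (ominus β t), h M β i t, ?_, ?_⟩, rfl⟩ <;> rw [h_mul_h, ← h0] <;> congr 1 <;>
    simp only [oplus, ominus] <;> linear_combination (-t) * e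

theorem isUnit_list_prod {A : Type*} [Monoid A] (l : List A) (hl : ∀ g ∈ l, IsUnit g) :
    IsUnit l.prod := by
  induction l with
  | nil => simp
  | cons g l ih =>
    rw [List.prod_cons]
    exact (hl g (by simp)).mul (ih fun k hk => hl k (by simp [hk]))

theorem isUnit_GA_ominus (b : ℕ → R) (hb : ∀ j, 1 ≤ j → j < n → IsUnit (1 + β * b j)) :
    IsUnit (GA β n fun j => ominus β (b j)) := by
  refine isUnit_list_prod _ fun g hg => ?_
  obtain ⟨i, hi, rfl⟩ := List.mem_map.1 hg
  rw [List.mem_range] at hi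
  refine isUnit_list_prod _ fun g' hg' => ?_
  obtain ⟨k, -, rfl⟩ := List.mem_map.1 hg'
  exact isUnit_h_ominus β _ k _ (hb (i + 1) (by omega) (by omega))

end Grothendieck

/-! ### The sequence `Δ_n^X`, its coordinates and weights -/

/-- An entry `s_letter` of the sequence `Δ_n^X` together with its coordinate `(i, j)`. -/
structure Cell (n : ℕ) where
  letter : Fin n
  i : ℕ
  j : ℕ

/-- The first part `(s_{n-1} | s_{n-2}, s_{n-1} | ⋯ | s_1, ..., s_{n-1})`: the row `m`
(`1 ≤ m ≤ n - 1`) is `s_{n-m}, ..., s_{n-1}` with coordinates `(1, 2n-m), ..., (m, 2n-m)`. -/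
def cellsA (n : ℕ) : List (Cell n) :=
  (List.finRange n).flatMap fun m : Fin n => (List.finRange (m : ℕ)).map fun c : Fin (m : ℕ) =>
    ⟨⟨n - (m : ℕ) + (c : ℕ), by omega⟩, (c : ℕ) + 1, 2 * n - (m : ℕ)⟩

/-- The second part `(s_0, s_1, ..., s_{n-1})^n`: the row `s` (`0 ≤ s ≤ n - 1`) has coordinates
`(s+1, n-s), ..., (s+n, n-s)`. -/
def cellsBC (n : ℕ) : List (Cell n) :=
  (List.finRange n).flatMap fun s : Fin n => (List.finRange n).map fun t : Fin n =>
    ⟨t, (s : ℕ) + ((t : ℕ) + 1), n - (s : ℕ)⟩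

/-- All entries of `Δ_n^X`, in order. -/
def cells (n : ℕ) : List (Cell n) := cellsA n ++ cellsBC n

/-- The sequence `Δ_n^X` of (indices of) simple reflections. -/
def delta (n : ℕ) : List (Fin n) := (cells n).map Cell.letter

/-- The `k`-th entry of `Δ_n^X` with its coordinate. -/
def cellAt (n : ℕ) (k : Fin (delta n).length) : Cell n :=
  (cells n).get (k.cast (by simp [delta]))

section Weights

variable {R : Type*} [CommRing R] (β : R) (n : ℕ) (X : Kind) (a b x : ℕ → R)

/-- `p_i = x_{n+1-i}` for `1 ≤ i ≤ n` and `p_i = a_{i-n}` for `i > n`. -/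
def p (i : ℕ) : R := if i ≤ n then x (n + 1 - i) else a (i - n)

/-- `q_j = x_j` for `1 ≤ j ≤ n` and `q_j = b_{j-n}` for `j > n`. -/
def q (j : ℕ) : R := if j ≤ n then x j else b (j - n)

/-- The weight at the coordinate `(i, j)`: it is `p_i ⊕ q_j`, except that for type `B` it is
`x_{n+1-i}` at `(i, n+1-i)`. -/
def wt (i j : ℕ) : R :=
  match X with
  | Kind.B => if i + j = n + 1 then x (n + 1 - i) else oplus β (p n a x i) (q n b x j)
  | Kind.C => oplus β (p n a x i) (q n b x j)

/-- The weight of the `k`-th entry of `Δ_n^X`. -/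
def wtAt (k : Fin (delta n).length) : R :=
  wt β n X a b x (cellAt n k).i (cellAt n k).j

/-- `Wt(D) = ∏_{□ ∈ D} wt(□) · ∏_{○ ∈ B(D)} (1 + β wt(○))`. -/
noncomputable def Wt {W : Type*} [Group W] (cs : CoxeterSystem (coxMatrix n) W)
    (J : Finset (Fin (delta n).length)) : R :=
  (∏ k ∈ J, wtAt β n X a b x k) *
    ∏ k ∈ backward cs (delta n) J, (1 + β * wtAt β n X a b x k)

end Weights

end TypeBC

/-! Multiply out a product of factors `h_i(t)` from left to right. In the basis `u_w`, the product
`u_v u_i` is `u_{v s_i}` if `s_i` lengthens `v`, and `β u_v` otherwise. At an ascent both choices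
`1` and `t u_i` survive; at a descent they merge into the factor `1 + β t`, with the letter left
unselected. Descents are exactly the letters absorbed by `⋆`, so the coefficients of such a product
over any word are sums over reduced subwords (`coeff_prod_h`). It remains to show that the
generating function is the product of the `h_{d_k}(wt(d_k))` (`genFun_eq_prod_delta`).

The engine is `Aasc_mul_Adesc`, a consequence of the type `A` Yang-Baxter equation: an ascending
product with argument `s` passes a descending one with argument `t` and leaves behind a single
`h_i(s ⊕ t)`. Passing it through all of `G_A` emits one row of cells. The ascending half of `F^X(x)`
does this, while its descending half prepends `x` to the arguments of `G_A`. Absorbing `x_1, ...,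
x_n` in turn changes `a` into `p`; then `G_A(⊖ b)⁻¹`, itself a product of ascending products,
consumes `G_A(p)` and emits the first part of `Δ`.

This absorbs the factors in the order `F(x_n) ⋯ F(x_1)`, so the `F(x_i)` must commute. The `B_2`
Yang-Baxter equation without denominators gives this up to a factor `1 + β y`, which is cancelled
over `ℤ[β, x, y]` before specializing (`commute_partialF`).

The cancellation and the coefficients themselves require that the `u_w` form a basis. Independence
comes from the left regular representation, spanning from Matsumoto's theorem; both rest on the
exchange property and on `s_i s_j` having order exactly `m_{i,j}`, which is read off from the
geometric representation. -/

namespace TypeBC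

/-! ### Exchange property and Matsumoto's theorem -/

section Coxeter

open List

variable {B : Type*} {M : CoxeterMatrix B} {W : Type*} [Group W] (cs : CoxeterSystem M W)

open Classical in
/-- The action of a simple reflection on `W × ℤ/2` underlying the reflection cocycle. -/
noncomputable def signedConj (i : B) : Function.End (W × ZMod 2) := fun x =>
  (cs.simple i * x.1 * cs.simple i, x.2 + if x.1 = cs.simple i then 1 else 0)

theorem end_mul_apply {α : Type*} (f g : Function.End α) (a : α) : (f * g) a = f (g a) := rfl

theorem end_one_apply {α : Type*} (a : α) : (1 : Function.End α) a = a := rfl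

-- Each of the `2n` letters adds a sign when the current conjugate of `t` equals that letter;
-- undoing the conjugation gives the dihedral reflections `s_j (s_i s_j)^k`.
open Classical in
theorem signedConj_mul_pow (i j : B) (n : ℕ) (t : W) (z : ZMod 2) :
    ((signedConj cs i * signedConj cs j) ^ n) (t, z) =
      ((cs.simple i * cs.simple j) ^ n * t * ((cs.simple i * cs.simple j) ^ n)⁻¹,
        z + ∑ k ∈ Finset.range (2 * n),
          if t = cs.simple j * (cs.simple i * cs.simple j) ^ k then 1 else 0) := by
  have hji : (cs.simple i * cs.simple j)⁻¹ = cs.simple j * cs.simple i := by simp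
  have key : ∀ n : ℕ, ((cs.simple i * cs.simple j) ^ n)⁻¹ * cs.simple j
      = cs.simple j * (cs.simple i * cs.simple j) ^ n := by
    intro n
    induction n with
    | zero => simp
    | succ n ih =>
      rw [pow_succ', mul_inv_rev, hji, mul_assoc, mul_assoc, ← mul_assoc _ _ (cs.simple j),
        mul_assoc _ (cs.simple j)]
      calc _ = (((cs.simple i * cs.simple j) ^ n)⁻¹ * cs.simple j) *
            (cs.simple i * cs.simple j) := by simp only [mul_assoc]
        _ = _ := by rw [ih, mul_assoc, ← pow_succ, pow_succ', mul_assoc]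
  induction n with
  | zero => simp [end_one_apply]
  | succ n ih =>
    rw [pow_succ', end_mul_apply, ih, end_mul_apply, show 2 * (n + 1) = 2 * n + 1 + 1 from rfl, Finset.sum_range_succ,
      Finset.sum_range_succ]
    set r := cs.simple i * cs.simple j with hr
    have e1 : (r ^ n * t * (r ^ n)⁻¹ = cs.simple j) ↔ t = cs.simple j * r ^ (2 * n) := by
      rw [mul_inv_eq_iff_eq_mul, ← eq_inv_mul_iff_mul_eq, ← mul_assoc, key, mul_assoc, ← pow_add,
        two_mul]
    have e2 : (cs.simple j * (r ^ n * t * (r ^ n)⁻¹) * cs.simple j = cs.simple i) ↔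
        t = cs.simple j * r ^ (2 * n + 1) := by
      rw [← eq_mul_inv_iff_mul_eq, ← eq_inv_mul_iff_mul_eq,
        mul_inv_eq_iff_eq_mul, ← eq_inv_mul_iff_mul_eq]
      simp only [CoxeterSystem.inv_simple]
      rw [show (r ^ n)⁻¹ * (cs.simple j * (cs.simple i * cs.simple j) * r ^ n) =
        ((r ^ n)⁻¹ * cs.simple j) * (r * r ^ n) by simp only [hr, mul_assoc], key, mul_assoc,
        ← pow_succ', ← pow_add, show n + (n + 1) = 2 * n + 1 by ring]
    simp only [signedConj]
    refine Prod.ext ?_ ?_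
    · simp only [pow_succ', mul_inv_rev, cs.inv_simple, hr, mul_assoc]
    · simp only [e1, e2, add_assoc]

/-- Since `(s_i s_j)^m = 1`, the terms `k` and `m + k` of the sign sum coincide and cancel modulo 2.
-/
theorem signedConj_isLiftable : M.IsLiftable (signedConj cs) := by
  classical
  intro i j
  funext x
  obtain ⟨t, z⟩ := x
  rw [signedConj_mul_pow, cs.simple_mul_simple_pow, two_mul, Finset.sum_range_add]
  simp only [pow_add, cs.simple_mul_simple_pow, one_mul, inv_one, mul_one, Function.End.one_def]
  rw [CharTwo.add_self_eq_zero, add_zero]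
  rfl

open Classical in
theorem prod_signedConj (ω : List B) (t : W) (z : ZMod 2) :
    (ω.map (signedConj cs)).prod (t, z) =
      (cs.wordProd ω * t * (cs.wordProd ω)⁻¹, z + ((cs.rightInvSeq ω).count t : ZMod 2)) := by
  induction ω with
  | nil => simp [end_one_apply]
  | cons i ω ih =>
    rw [map_cons, prod_cons, end_mul_apply, ih, signedConj,
      CoxeterSystem.rightInvSeq, count_cons, cs.wordProd_cons]
    refine Prod.ext ?_ ?_
    · simp [mul_assoc]
    · have : (cs.wordProd ω * t * (cs.wordProd ω)⁻¹ = cs.simple i) ↔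
          (cs.wordProd ω)⁻¹ * cs.simple i * cs.wordProd ω = t := by
        rw [mul_inv_eq_iff_eq_mul, mul_assoc, inv_mul_eq_iff_eq_mul, eq_comm]
      simp only [this, beq_iff_eq]
      split_ifs <;> simp [add_assoc]

open Classical in
/-- The parity of the multiplicity of `t` in the right inversion sequence of a word depends only on
the product of the word. -/
theorem count_rightInvSeq_eq {ω ω' : List B} (hω : cs.wordProd ω = cs.wordProd ω') (t : W) :
    ((cs.rightInvSeq ω).count t : ZMod 2) = (cs.rightInvSeq ω').count t := by
  have lift_eq (ω : List B) : cs.lift ⟨_, signedConj_isLiftable cs⟩ (cs.wordProd ω) =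
      (ω.map (signedConj cs)).prod := by
    rw [CoxeterSystem.wordProd, map_list_prod, map_map]
    congr 2
    funext i
    exact cs.lift_apply_simple (signedConj_isLiftable cs) i
  have h := congrFun ((lift_eq ω).symm.trans ((congrArg _ hω).trans (lift_eq ω'))) (t, 0)
  rw [prod_signedConj, prod_signedConj] at h
  simpa using congrArg Prod.snd h

/-- The exchange property, in terms of inversion sequences. -/
theorem simple_mem_rightInvSeq {ω : List B} {i : B} (h : cs.IsRightDescent (cs.wordProd ω) i) :
    cs.simple i ∈ cs.rightInvSeq ω := by
  classical
  -- A reduced word of `w s_i` followed by `i` is a reduced word of `w` in whose inversion sequence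
  -- `s_i` occurs exactly once; the odd parity transfers to `ω`.
  obtain ⟨ω', h', e⟩ := cs.exists_isReduced (cs.wordProd ω * cs.simple i)
  have e' : cs.wordProd (ω'.concat i) = cs.wordProd ω := by
    rw [cs.wordProd_concat, ← e, cs.simple_mul_simple_cancel_right]
  have hr : cs.IsReduced (ω'.concat i) := by
    have := cs.isRightDescent_iff.1 h
    rw [e, h'.eq] at this
    rw [CoxeterSystem.IsReduced, e', length_concat, this]
  have h1 : (cs.rightInvSeq (ω'.concat i)).count (cs.simple i) = 1 := by
    refine count_eq_one_of_mem hr.nodup_rightInvSeq ?_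
    rw [cs.rightInvSeq_concat]
    simp
  have h2 := count_rightInvSeq_eq cs e' (cs.simple i)
  rw [h1] at h2
  by_contra hn
  rw [count_eq_zero_of_not_mem hn] at h2
  simp at h2

theorem exists_eraseIdx_of_mem_rightInvSeq {ω : List B} {t : W} (h : t ∈ cs.rightInvSeq ω) :
    ∃ k < ω.length, cs.wordProd ω * t = cs.wordProd (ω.eraseIdx k) := by
  obtain ⟨k, hk, rfl⟩ := getElem_of_mem h
  refine ⟨k, by simpa using hk, ?_⟩
  rw [← cs.wordProd_mul_getD_rightInvSeq, getD_eq_getElem _ _ hk]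

theorem rightInvSeq_append (ω ω' : List B) :
    cs.rightInvSeq (ω ++ ω') =
      (cs.rightInvSeq ω).map (MulAut.conj (cs.wordProd ω')⁻¹) ++ cs.rightInvSeq ω' := by
  induction ω with
  | nil => simp
  | cons i ω ih =>
    simp [CoxeterSystem.rightInvSeq, ih, cs.wordProd_append, mul_assoc]

/-- Right multiplication by a right descent deletes a letter. -/
theorem exists_eraseIdx_of_isRightDescent {ω : List B} {i : B}
    (h : cs.IsRightDescent (cs.wordProd ω) i) :
    ∃ k < ω.length, cs.wordProd ω * cs.simple i = cs.wordProd (ω.eraseIdx k) :=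
  exists_eraseIdx_of_mem_rightInvSeq cs (simple_mem_rightInvSeq cs h)

theorem mem_rightInvSeq_alternatingWord (k : ℕ) (i i' : B) {t : W}
    (h : t ∈ cs.rightInvSeq (CoxeterSystem.alternatingWord i i' k)) :
    ∃ j < k, t = (cs.simple i' * cs.simple i) ^ j * cs.simple i' := by
  induction k generalizing i i' t with
  | zero => simp [CoxeterSystem.alternatingWord] at h
  | succ k ih =>
    rw [CoxeterSystem.alternatingWord_succ, cs.rightInvSeq_concat, concat_eq_append, mem_append,
      mem_singleton] at h
    obtain h | rfl := h
    · obtain ⟨t, ht, rfl⟩ := mem_map.1 h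
      obtain ⟨j, hj, rfl⟩ := ih _ _ ht
      refine ⟨j + 1, by omega, ?_⟩
      have : SemiconjBy (cs.simple i') (cs.simple i * cs.simple i')
          (cs.simple i' * cs.simple i) := by simp [SemiconjBy, mul_assoc]
      have := this.pow_right j
      rw [MulAut.conj_apply, cs.inv_simple, ← mul_assoc, this.eq, pow_succ]
      simp only [mul_assoc]
    · exact ⟨0, by omega, by simp⟩

/-- Otherwise `s_i = (s_{i'} s_i)^j s_{i'}` with `j < k`, so `(s_{i'} s_i)^(j+1) = 1` with an
exponent below the order. -/
theorem simple_notMem_rightInvSeq_alternatingWord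
    (hM : ∀ i j, orderOf (cs.simple i * cs.simple j) = M i j) {k : ℕ} {i i' : B} (hk : k < M i i') :
    cs.simple i ∉ cs.rightInvSeq (CoxeterSystem.alternatingWord i i' k) := by
  intro h
  obtain ⟨j, hj, e⟩ := mem_rightInvSeq_alternatingWord cs k i i' h
  have : (cs.simple i' * cs.simple i) ^ (j + 1) = 1 := by
    rw [pow_succ, ← mul_assoc, ← e, cs.simple_mul_simple_self]
  have := orderOf_le_of_pow_eq_one (by omega) this
  rw [hM, M.symmetric] at this
  omega

/-- Alternating words of length at most `M i i'` are reduced. -/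
theorem isReduced_alternatingWord
    (hM : ∀ i j, orderOf (cs.simple i * cs.simple j) = M i j) {k : ℕ} {i i' : B}
    (hk : k ≤ M i i') : cs.IsReduced (CoxeterSystem.alternatingWord i i' k) := by
  induction k generalizing i i' with
  | zero => simp [CoxeterSystem.alternatingWord, CoxeterSystem.IsReduced]
  | succ k ih =>
    have hk' : k < M i' i := by rw [M.symmetric]; omega
    have h := ih hk'.le
    have hd : ¬ cs.IsRightDescent (cs.wordProd (CoxeterSystem.alternatingWord i' i k)) i' :=
      fun hd => simple_notMem_rightInvSeq_alternatingWord cs hM hk' (simple_mem_rightInvSeq cs hd)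
    rw [cs.not_isRightDescent_iff, h.eq] at hd
    rw [CoxeterSystem.IsReduced, CoxeterSystem.alternatingWord_succ, cs.wordProd_concat, hd,
      length_concat]

/-- An element with right descents `i` and `i'` has reduced words ending with every alternating
word in `i` and `i'` of length at most `M i i'`. -/
theorem exists_append_alternatingWord
    (hM : ∀ i j, orderOf (cs.simple i * cs.simple j) = M i j) (w : W) (k : ℕ) (i i' : B)
    (hi : cs.IsRightDescent w i) (hi' : cs.IsRightDescent w i') (hk : k ≤ M i i') :
    ∃ ω : List B, cs.wordProd (ω ++ CoxeterSystem.alternatingWord i i' k) = w ∧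
      ω.length + k = cs.length w := by
  induction k generalizing i i' with
  | zero =>
    obtain ⟨ω, h, e⟩ := cs.exists_isReduced w
    exact ⟨ω, by simp [CoxeterSystem.alternatingWord, e], by rw [e, h.eq]; rfl⟩
  | succ k ih =>
    have hk' : k < M i' i := by rw [M.symmetric]; omega
    obtain ⟨ω, e, hl⟩ := ih i' i hi' hi hk'.le
    have h := hi'
    rw [← e] at h
    have h := simple_mem_rightInvSeq cs h
    rw [rightInvSeq_append, mem_append] at h
    -- The exchanged letter lies in `ω`, where it can be deleted and `i'` appended, or in the
    -- alternating tail, which is too short to produce `s_{i'}`.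
    obtain h | h := h
    · obtain ⟨t, ht, et⟩ := mem_map.1 h
      obtain ⟨j, hj, ej⟩ := exists_eraseIdx_of_mem_rightInvSeq cs ht
      have e2 : w * cs.simple i' =
          cs.wordProd (ω.eraseIdx j) * cs.wordProd (CoxeterSystem.alternatingWord i' i k) := by
        rw [← et, ← ej, ← e, cs.wordProd_append, MulAut.conj_apply]
        group
      refine ⟨ω.eraseIdx j, ?_, ?_⟩
      · rw [CoxeterSystem.alternatingWord_succ, cs.wordProd_append, cs.wordProd_concat,
          ← mul_assoc, ← e2, cs.simple_mul_simple_cancel_right]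
      · have := length_eraseIdx_add_one hj
        omega
    · exact absurd h (simple_notMem_rightInvSeq_alternatingWord cs hM hk')

/-- **Matsumoto's theorem**: a product over the letters of a reduced word that respects the braid
relations depends only on the element of the group. -/
theorem prod_map_eq_of_isReduced (hM : ∀ i j, orderOf (cs.simple i * cs.simple j) = M i j)
    (hM0 : ∀ i j, M i j ≠ 0) {A : Type*} [Monoid A] (f : B → A)
    (hf : ∀ i j, ((CoxeterSystem.braidWord M i j).map f).prod =
      ((CoxeterSystem.braidWord M j i).map f).prod) {ω ω' : List B} (hω : cs.IsReduced ω)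
    (hω' : cs.IsReduced ω') (e : cs.wordProd ω = cs.wordProd ω') :
    (ω.map f).prod = (ω'.map f).prod := by
  induction hn : ω.length using Nat.strong_induction_on generalizing ω ω' with
  | _ n ih =>
  have hlen : ω'.length = ω.length := by rw [← hω.eq, ← hω'.eq, e]
  have same_last {σ σ' : List B} {i : B} (h : cs.IsReduced (σ ++ [i]))
      (h' : cs.IsReduced (σ' ++ [i])) (hσ : σ.length + 1 = n)
      (e : cs.wordProd (σ ++ [i]) = cs.wordProd (σ' ++ [i])) :
      ((σ ++ [i]).map f).prod = ((σ' ++ [i]).map f).prod := by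
    have r : cs.IsReduced σ := by simpa using h.take σ.length
    have r' : cs.IsReduced σ' := by simpa using h'.take σ'.length
    rw [cs.wordProd_append, cs.wordProd_append, mul_left_inj] at e
    simp only [map_append, prod_append]
    rw [ih σ.length (by omega) r r' e rfl]
  have descent {σ : List B} {i : B} (h : cs.IsReduced (σ ++ [i])) :
      cs.IsRightDescent (cs.wordProd (σ ++ [i])) i := by
    rw [CoxeterSystem.IsRightDescent, h.eq, cs.wordProd_append, cs.wordProd_singleton,
      cs.simple_mul_simple_cancel_right, length_append, length_singleton]
    exact Nat.lt_succ_of_le (cs.length_wordProd_le _)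
  obtain rfl | ⟨σ, i, rfl⟩ := eq_nil_or_concat' ω
  · rw [length_nil, length_eq_zero_iff] at hlen
    rw [hlen]
  obtain rfl | ⟨σ', i', rfl⟩ := eq_nil_or_concat' ω'
  · simp at hlen
  simp only [length_append, length_singleton] at hlen hn
  have di := descent hω
  have di' := descent hω'
  rw [← e] at di'
  -- Both words are compared with `τ` followed by a braid word ending in the same letter, where
  -- induction applies after removing that letter. The case `i = i'` is included, as then `M i i' =
  -- 1`.
  obtain ⟨τ, eτ, hτ⟩ := exists_append_alternatingWord cs hM _ (M i i') i i' di di' le_rfl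
  have key (j j' : B) (hj : M j' j = M i i')
      (e' : cs.wordProd (CoxeterSystem.braidWord M j' j) =
        cs.wordProd (CoxeterSystem.braidWord M i i')) {σ : List B} (h : cs.IsReduced (σ ++ [j]))
      (eσ : cs.wordProd (σ ++ [j]) = cs.wordProd (τ ++ CoxeterSystem.braidWord M i i'))
      (hσ : σ.length + 1 = n) :
      ((σ ++ [j]).map f).prod = ((τ ++ CoxeterSystem.braidWord M j' j).map f).prod := by
    obtain ⟨m, hm⟩ : ∃ m, M j' j = m + 1 := Nat.exists_eq_succ_of_ne_zero (hM0 _ _)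
    have e2 : τ ++ CoxeterSystem.braidWord M j' j =
        (τ ++ CoxeterSystem.alternatingWord j j' m) ++ [j] := by
      rw [CoxeterSystem.braidWord, hm, CoxeterSystem.alternatingWord_succ, concat_eq_append,
        append_assoc]
    have e3 : cs.wordProd (σ ++ [j]) = cs.wordProd (τ ++ CoxeterSystem.braidWord M j' j) := by
      rw [eσ, cs.wordProd_append, cs.wordProd_append, e']
    have r : cs.IsReduced (τ ++ CoxeterSystem.braidWord M j' j) := by
      rw [CoxeterSystem.IsReduced, ← e3, h.eq, length_append, length_append,
        CoxeterSystem.length_alternatingWord, hj, hτ, ← eτ, ← eσ, h.eq, length_append]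
    rw [e2] at e3 r ⊢
    exact same_last h r hσ e3
  rw [key i i' (M.symmetric _ _) (cs.wordProd_braidWord_eq _ _) hω eτ.symm hn,
    key i' i rfl rfl hω' (e.symm.trans eτ.symm) (by omega)]
  simp only [map_append, prod_append, hf i' i]

/-- One may assume that `s_i` lengthens `w`. Then `s_j` is a right descent of `s_i w`, and exchange
deletes a letter: deleting the leading `s_i` is the claim, deleting any other would make `w s_j`
shorter than `w`. -/
theorem simple_mul_eq_mul_simple {w : W} {i j : B}
    (h : cs.length (cs.simple i * w * cs.simple j) = cs.length w)
    (h' : cs.length (cs.simple i * w) = cs.length (w * cs.simple j)) :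
    cs.simple i * w = w * cs.simple j := by
  have key (w : W) (h : cs.length (cs.simple i * w * cs.simple j) = cs.length w)
      (h' : cs.length (cs.simple i * w) = cs.length (w * cs.simple j))
      (h1 : cs.length (cs.simple i * w) = cs.length w + 1) :
      cs.simple i * w = w * cs.simple j := by
    obtain ⟨ω, hω, rfl⟩ := cs.exists_isReduced w
    have hd : cs.IsRightDescent (cs.wordProd (i :: ω)) j := by
      rw [CoxeterSystem.IsRightDescent, cs.wordProd_cons]
      omega
    obtain ⟨k, hk, e⟩ := exists_eraseIdx_of_isRightDescent cs hd
    cases k with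
    | zero =>
      rw [cs.wordProd_cons, eraseIdx_cons_zero] at e
      conv_rhs => rw [← e]
      rw [cs.simple_mul_simple_cancel_right]
    | succ k =>
      rw [eraseIdx_cons_succ, cs.wordProd_cons, cs.wordProd_cons, mul_assoc, mul_right_inj] at e
      have h3 := cs.length_wordProd_le (ω.eraseIdx k)
      have h4 := length_eraseIdx_add_one (l := ω) (i := k) (by simpa using hk)
      rw [← e] at h3
      have := hω.eq
      omega
  obtain h1 | h1 := cs.length_simple_mul w i
  · exact key w h h' h1
  · have := key (cs.simple i * w) (by rw [cs.simple_mul_simple_cancel_left]; omega)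
      (by rw [cs.simple_mul_simple_cancel_left]; omega)
      (by rw [cs.simple_mul_simple_cancel_left]; omega)
    rw [cs.simple_mul_simple_cancel_left, mul_assoc] at this
    conv_lhs => rw [this]
    rw [cs.simple_mul_simple_cancel_left]

end Coxeter

/-! ### The basis of the idCoxeter algebra -/

section Basis

variable {B : Type*} {M : CoxeterMatrix B} {W : Type*} [Group W]
variable {R : Type*} [CommRing R] (β : R) (cs : CoxeterSystem M W)

/-- The operator `e_w ↦ e_{s_i w}` or `β e_w` on the free module on `W`. -/
noncomputable def leftOp (i : B) : Module.End R (W →₀ R) :=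
  Finsupp.linearCombination R fun w =>
    if cs.length (cs.simple i * w) < cs.length w then β • Finsupp.single w 1
    else Finsupp.single (cs.simple i * w) 1

/-- The operator `e_w ↦ e_{w s_i}` or `β e_w` on the free module on `W`. -/
noncomputable def rightOp (i : B) : Module.End R (W →₀ R) :=
  Finsupp.linearCombination R fun w =>
    if cs.length (w * cs.simple i) < cs.length w then β • Finsupp.single w 1
    else Finsupp.single (w * cs.simple i) 1

theorem leftOp_single (i : B) (w : W) : leftOp β cs i (Finsupp.single w 1) =
    if cs.length (cs.simple i * w) < cs.length w then β • Finsupp.single w 1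
    else Finsupp.single (cs.simple i * w) 1 := by
  simp [leftOp]

theorem rightOp_single (i : B) (w : W) : rightOp β cs i (Finsupp.single w 1) =
    if cs.length (w * cs.simple i) < cs.length w then β • Finsupp.single w 1
    else Finsupp.single (w * cs.simple i) 1 := by
  simp [rightOp]

omit [Group W] in
theorem end_ext_single {f g : Module.End R (W →₀ R)}
    (h : ∀ w, f (Finsupp.single w 1) = g (Finsupp.single w 1)) : f = g :=
  Finsupp.lhom_ext' fun w => LinearMap.ext_ring (h w)

/-- Only one case is not settled by lengths alone: both `s_i w` and `w s_j` are longer than `w` but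
`s_i w s_j` is not. There `s_i w = w s_j`, and both orders give `β` times the same basis vector. -/
theorem commute_leftOp_rightOp (i j : B) : Commute (leftOp β cs i) (rightOp β cs j) := by
  refine end_ext_single fun w => ?_
  rw [Module.End.mul_apply, Module.End.mul_apply, rightOp_single, leftOp_single]
  have h1 := cs.length_simple_mul w i
  have h2 := cs.length_mul_simple w j
  have h3 := cs.length_simple_mul (w * cs.simple j) i
  have h4 := cs.length_mul_simple (cs.simple i * w) j
  rw [← mul_assoc] at h3
  split_ifs with h h' h'
  · rw [map_smul, map_smul, rightOp_single, leftOp_single, if_pos h, if_pos h']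
  · rw [map_smul, leftOp_single, rightOp_single, if_neg h', if_pos (by omega)]
  · rw [map_smul, leftOp_single, rightOp_single, if_neg h, if_pos (by rw [← mul_assoc]; omega)]
  · rw [leftOp_single, rightOp_single, ← mul_assoc]
    by_cases h5 : cs.length (cs.simple i * w * cs.simple j) = cs.length w
    · have e := simple_mul_eq_mul_simple cs h5 (by omega)
      rw [if_pos (by omega), if_pos (by omega), e]
    · rw [if_neg (by omega), if_neg (by omega)]

theorem prod_leftOp_single_one {ω : List B} (h : cs.IsReduced ω) :
    (ω.map (leftOp β cs)).prod (Finsupp.single 1 1) = Finsupp.single (cs.wordProd ω) 1 := by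
  induction ω with
  | nil => simp
  | cons i ω ih =>
    have h' : cs.IsReduced ω := by simpa using h.drop 1
    have := h.eq
    have := h'.eq
    rw [List.map_cons, List.prod_cons, Module.End.mul_apply, ih h', leftOp_single, if_neg,
      cs.wordProd_cons]
    rw [← cs.wordProd_cons, h.eq, h'.eq, List.length_cons]
    omega

theorem prod_rightOp_single_one {ω : List B} (h : cs.IsReduced ω) :
    (ω.reverse.map (rightOp β cs)).prod (Finsupp.single 1 1) =
      Finsupp.single (cs.wordProd ω) 1 := by
  induction ω using List.reverseRecOn with
  | nil => simp
  | append_singleton ω i ih =>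
    have h' : cs.IsReduced ω := by simpa using h.take ω.length
    have e : cs.wordProd (ω ++ [i]) = cs.wordProd ω * cs.simple i := by
      rw [cs.wordProd_append, cs.wordProd_singleton]
    rw [List.reverse_append, List.reverse_singleton, List.singleton_append, List.map_cons,
      List.prod_cons, Module.End.mul_apply, ih h', rightOp_single, if_neg, e]
    rw [← e, h.eq, h'.eq, List.length_append]
    omega

theorem commute_prod_map {A B' : Type*} [Monoid A] {f : B → A} {g : B' → A}
    (h : ∀ i j, Commute (f i) (g j)) (l : List B) (l' : List B') :
    Commute (l.map f).prod (l'.map g).prod := by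
  refine Commute.list_prod_left _ _ fun a ha => Commute.list_prod_right _ _ fun b hb => ?_
  obtain ⟨i, -, rfl⟩ := List.mem_map.1 ha
  obtain ⟨j, -, rfl⟩ := List.mem_map.1 hb
  exact h i j

/-- The products of left operators along two reduced words of the same element agree. -/
theorem prod_leftOp_eq {ω ω' : List B} (h : cs.IsReduced ω) (h' : cs.IsReduced ω')
    (e : cs.wordProd ω = cs.wordProd ω') :
    (ω.map (leftOp β cs)).prod = (ω'.map (leftOp β cs)).prod := by
  refine end_ext_single fun w => ?_
  -- Right operators build `e_w` from `e_1` and commute with the left ones, so it suffices to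
  -- compare the two products on `e_1`.
  obtain ⟨τ, hτ, rfl⟩ := cs.exists_isReduced w
  have c (σ : List B) := commute_prod_map (commute_leftOp_rightOp β cs) σ τ.reverse
  rw [← prod_rightOp_single_one β cs hτ, ← Module.End.mul_apply, ← Module.End.mul_apply,
    (c ω).eq, (c ω').eq, Module.End.mul_apply, Module.End.mul_apply,
    prod_leftOp_single_one β cs h, prod_leftOp_single_one β cs h', e]

theorem leftOp_mul_self (i : B) : leftOp β cs i * leftOp β cs i = β • leftOp β cs i := by
  refine end_ext_single fun w => ?_
  rw [Module.End.mul_apply, LinearMap.smul_apply, leftOp_single]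
  split_ifs with h
  · rw [map_smul, leftOp_single, if_pos h]
  · rw [leftOp_single, cs.simple_mul_simple_cancel_left, if_pos]
    have := cs.length_simple_mul_ne w i
    omega

/-! ### Linear independence of the `u_w`. -/

section Faithful

variable (hM : ∀ i j, orderOf (cs.simple i * cs.simple j) = M i j)

/-- The left regular representation of the idCoxeter algebra on the free module on `W`. -/
noncomputable def leftRep : IdAlg M β →ₐ[R] Module.End R (W →₀ R) :=
  RingQuot.liftAlgHom R ⟨FreeAlgebra.lift R (leftOp β cs), by
    intro a b hab
    cases hab with
    | sq i => simp [leftOp_mul_self]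
    | braid i j =>
      simp only [map_list_prod, List.map_map, Function.comp_def, FreeAlgebra.lift_ι_apply]
      exact prod_leftOp_eq β cs (isReduced_alternatingWord cs hM le_rfl)
        (isReduced_alternatingWord cs hM le_rfl) (cs.wordProd_braidWord_eq i j)⟩

theorem leftRep_u (i : B) : leftRep β cs hM (u M β i) = leftOp β cs i := by
  simp [leftRep, u]

/-- Evaluation at `e_1` thus reads off coefficients, which is the linear independence of the `u_w`.
-/
theorem leftRep_uW_single_one (w : W) :
    leftRep β cs hM (uW β cs w) (Finsupp.single 1 1) = Finsupp.single w 1 := by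
  have h := Classical.choose_spec (cs.exists_isReduced w)
  rw [uW, map_list_prod, List.map_map]
  simp only [Function.comp_def, leftRep_u]
  rw [prod_leftOp_single_one β cs h.1, ← h.2]

theorem IsExpansion.eq_leftRep {g : IdAlg M β} {c : W →₀ R} (h : IsExpansion β cs g c) :
    c = leftRep β cs hM g (Finsupp.single 1 1) := by
  rw [h, Finsupp.sum, map_sum, LinearMap.sum_apply]
  simp only [map_smul, LinearMap.smul_apply, leftRep_uW_single_one, Finsupp.smul_single,
    smul_eq_mul, mul_one]
  exact c.sum_single.symm

include hM in
theorem IsExpansion.unique {g : IdAlg M β} {c c' : W →₀ R} (h : IsExpansion β cs g c)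
    (h' : IsExpansion β cs g c') : c = c' :=
  (h.eq_leftRep β cs hM).trans (h'.eq_leftRep β cs hM).symm

include hM in
-- Uniqueness of expansions makes the choice inside `coeff` harmless.
theorem coeff_eq {g : IdAlg M β} {c : W →₀ R} (h : IsExpansion β cs g c) (w : W) :
    coeff β cs g w = c w := by
  have hg : ∃ c : W →₀ R, IsExpansion β cs g c := ⟨c, h⟩
  rw [coeff, dif_pos hg, hg.choose_spec.unique β cs hM h]

end Faithful

theorem prod_u_braidWord (i j : B) :
    ((CoxeterSystem.braidWord M i j).map (u M β)).prod =
      ((CoxeterSystem.braidWord M j i).map (u M β)).prod := by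
  have := RingQuot.mkAlgHom_rel R (IdRel.braid (M := M) (β := β) i j)
  rw [map_list_prod, map_list_prod, List.map_map, List.map_map] at this
  exact this

/-! ### Multiplication rules, and spanning by the `u_w`. -/

section Multiplication

variable (hM : ∀ i j, orderOf (cs.simple i * cs.simple j) = M i j) (hM0 : ∀ i j, M i j ≠ 0)

include hM hM0

theorem uW_wordProd {ω : List B} (h : cs.IsReduced ω) :
    uW β cs (cs.wordProd ω) = (ω.map (u M β)).prod := by
  have h' := Classical.choose_spec (cs.exists_isReduced (cs.wordProd ω))
  exact prod_map_eq_of_isReduced cs hM hM0 _ (prod_u_braidWord β) h'.1 h h'.2.symm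

theorem uW_one : uW β cs 1 = 1 := by
  have := uW_wordProd β cs hM hM0 (ω := []) (by simp [CoxeterSystem.IsReduced])
  simpa using this

theorem uW_mul_u_of_not_isRightDescent {w : W} {i : B} (h : ¬ cs.IsRightDescent w i) :
    uW β cs w * u M β i = uW β cs (w * cs.simple i) := by
  obtain ⟨ω, hω, rfl⟩ := cs.exists_isReduced w
  have e : cs.wordProd (ω ++ [i]) = cs.wordProd ω * cs.simple i := by
    rw [cs.wordProd_append, cs.wordProd_singleton]
  have h' : cs.IsReduced (ω ++ [i]) := by
    rw [CoxeterSystem.IsReduced, e, cs.not_isRightDescent_iff.1 h, hω.eq, List.length_append,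
      List.length_singleton]
  rw [uW_wordProd β cs hM hM0 hω, ← e, uW_wordProd β cs hM hM0 h']
  simp

theorem uW_mul_u_of_isRightDescent {w : W} {i : B} (h : cs.IsRightDescent w i) :
    uW β cs w * u M β i = β • uW β cs w := by
  have := uW_mul_u_of_not_isRightDescent β cs hM hM0
    (cs.isRightDescent_iff_not_isRightDescent_mul.1 h)
  rw [cs.simple_mul_simple_cancel_right] at this
  rw [← this, mul_assoc, u_mul_self, mul_smul_comm]

theorem uW_simple (i : B) : uW β cs (cs.simple i) = u M β i := by
  have := uW_mul_u_of_not_isRightDescent β cs hM hM0 (cs.not_isRightDescent_one i)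
  rw [uW_one β cs hM hM0, one_mul, one_mul] at this
  exact this.symm

theorem mem_span_uW (g : IdAlg M β) : g ∈ Submodule.span R (Set.range (uW β cs)) := by
  obtain ⟨a, rfl⟩ := RingQuot.mkAlgHom_surjective R (IdRel M β) g
  -- Stability of the span under right multiplication is the form that survives products in the
  -- induction; it is then applied to `1 = u_1`.
  suffices ∀ x ∈ Submodule.span R (Set.range (uW β cs)),
      x * RingQuot.mkAlgHom R (IdRel M β) a ∈ Submodule.span R (Set.range (uW β cs)) by
    have h := this 1 (Submodule.subset_span ⟨1, uW_one β cs hM hM0⟩)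
    rwa [one_mul] at h
  induction a using FreeAlgebra.induction with
  | grade0 r =>
    intro x hx
    rw [AlgHom.commutes, ← Algebra.commutes, ← Algebra.smul_def]
    exact Submodule.smul_mem _ _ hx
  | grade1 i =>
    intro x hx
    induction hx using Submodule.span_induction with
    | mem x hx =>
      obtain ⟨w, rfl⟩ := hx
      change uW β cs w * u M β i ∈ _
      by_cases h : cs.IsRightDescent w i
      · rw [uW_mul_u_of_isRightDescent β cs hM hM0 h]
        exact Submodule.smul_mem _ _ (Submodule.subset_span ⟨_, rfl⟩)
      · rw [uW_mul_u_of_not_isRightDescent β cs hM hM0 h]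
        exact Submodule.subset_span ⟨_, rfl⟩
    | zero => rw [zero_mul]; exact Submodule.zero_mem _
    | add x y _ _ hx hy => rw [add_mul]; exact Submodule.add_mem _ hx hy
    | smul r x _ hx => rw [smul_mul_assoc]; exact Submodule.smul_mem _ _ hx
  | mul a b ha hb =>
    intro x hx
    rw [map_mul, ← mul_assoc]
    exact hb _ (ha _ hx)
  | add a b ha hb =>
    intro x hx
    rw [map_add, mul_add]
    exact Submodule.add_mem _ (ha _ hx) (hb _ hx)

theorem exists_isExpansion (g : IdAlg M β) : ∃ c : W →₀ R, IsExpansion β cs g c := by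
  obtain ⟨c, hc⟩ := Finsupp.mem_span_range_iff_exists_finsupp.1 (mem_span_uW β cs hM hM0 g)
  exact ⟨c, hc.symm⟩

/-- The idCoxeter algebra is torsion-free. -/
theorem eq_zero_of_smul_eq_zero {r : R} (hr : r ∈ nonZeroDivisors R) {g : IdAlg M β}
    (h : r • g = 0) : g = 0 := by
  obtain ⟨c, hc⟩ := exists_isExpansion β cs hM hM0 g
  have e := hc.eq_leftRep β cs hM
  have h0 : c = 0 := by
    have h1 : r • c = 0 := by
      rw [e, ← LinearMap.smul_apply, ← map_smul, h, map_zero, LinearMap.zero_apply]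
    ext w
    have := DFunLike.congr_fun h1 w
    rw [Finsupp.smul_apply, smul_eq_mul] at this
    exact (mul_left_mem_nonZeroDivisors_eq_zero_iff hr).1 this
  rw [hc, h0, Finsupp.sum_zero_index]

theorem eq_of_smul_eq_smul {r : R} (hr : r ∈ nonZeroDivisors R) {g g' : IdAlg M β}
    (h : r • g = r • g') : g = g' :=
  sub_eq_zero.1 (eq_zero_of_smul_eq_zero β cs hM hM0 hr (by rw [smul_sub, h, sub_self]))

/-- A letter is absorbed by the Demazure product exactly at the descents. -/
theorem isDemazure_simple_iff (w : W) (i : B) :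
    IsDemazure cs w (cs.simple i) w ↔ cs.IsRightDescent w i := by
  rw [IsDemazure, uW_simple _ cs hM hM0, cs.length_simple, Nat.add_sub_cancel_left, pow_one]
  refine ⟨fun h => ?_, fun h => ⟨by omega, uW_mul_u_of_isRightDescent _ cs hM hM0 h⟩⟩
  -- At an ascent the Demazure identity would read `u_{ws} = X u_w`, which fails in the coefficient
  -- of `w`.
  by_contra hd
  have h2 := h.2
  rw [uW_mul_u_of_not_isRightDescent _ cs hM hM0 hd] at h2
  have h3 := congrArg (fun g => leftRep _ cs hM g (Finsupp.single 1 1) w) h2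
  simp only [map_smul, LinearMap.smul_apply, leftRep_uW_single_one, Finsupp.smul_single] at h3
  rw [Finsupp.single_eq_same, Finsupp.single_eq_of_ne] at h3
  · simp only [smul_eq_mul, mul_one] at h3
    exact Polynomial.X_ne_zero h3.symm
  · intro e
    exact cs.length_mul_simple_ne w i (by rw [← e])

end Multiplication

end Basis

/-! ### The orders of the products of two generators in type `B_n = C_n` -/

section Orders

/-- The Cartan integers of a root system with Weyl group of type `B_n = C_n`. -/
def cartan (n : ℕ) (i j : Fin n) : ℤ :=
  if i = j then 2
  else if (i : ℕ) = 0 ∧ (j : ℕ) = 1 then -2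
  else if (i : ℕ) + 1 = j ∨ (j : ℕ) + 1 = i then -1 else 0

/-- The pairing with the `i`-th simple coroot on the root lattice. -/
noncomputable def coroot (n : ℕ) (i : Fin n) : (Fin n →₀ ℤ) →ₗ[ℤ] ℤ :=
  Finsupp.linearCombination ℤ (cartan n i)

theorem coroot_single (n : ℕ) (i j : Fin n) :
    coroot n i (Finsupp.single j 1) = cartan n i j := by
  simp [coroot]

/-- The rank one endomorphism of the root lattice given by a coroot and a root. -/
noncomputable def corootSmulRoot (n : ℕ) (i j : Fin n) : Module.End ℤ (Fin n →₀ ℤ) :=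
  (coroot n j).smulRight (Finsupp.single i 1)

theorem corootSmulRoot_mul (n : ℕ) (i j k l : Fin n) :
    corootSmulRoot n i j * corootSmulRoot n k l = cartan n j k • corootSmulRoot n i l := by
  refine LinearMap.ext fun v => ?_
  simp only [corootSmulRoot, Module.End.mul_apply, LinearMap.smulRight_apply, map_smul,
    coroot_single, LinearMap.smul_apply, smul_smul]
  rw [mul_comm]

/-- The reflection at a simple root. -/
noncomputable def rootReflection (n : ℕ) (i : Fin n) : Module.End ℤ (Fin n →₀ ℤ) :=
  1 - corootSmulRoot n i i

theorem rootReflection_single (n : ℕ) (i j : Fin n) :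
    rootReflection n i (Finsupp.single j 1) =
      Finsupp.single j 1 - cartan n i j • Finsupp.single i 1 := by
  simp [rootReflection, corootSmulRoot, coroot_single]

theorem rootReflection_mul_self (n : ℕ) (i : Fin n) :
    rootReflection n i * rootReflection n i = 1 := by
  have h : corootSmulRoot n i i * corootSmulRoot n i i = 2 • corootSmulRoot n i i := by
    rw [corootSmulRoot_mul, cartan, if_pos rfl]
    rfl
  rw [rootReflection, sub_mul, one_mul, mul_sub, mul_one, h]
  abel

/-- Reflections are `1 - E_ii` with `E_ij E_kl = c_jk E_il`, so the braid relations are checked on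
combinations of these rank one maps, and only the Cartan integers matter. With `s² = 1` they give
the required powers. -/
theorem rootReflection_isLiftable (n : ℕ) : (coxMatrix n).IsLiftable (rootReflection n) := by
  intro i j
  have si := rootReflection_mul_self n i
  have sj := rootReflection_mul_self n j
  have expand (k l : Fin n) : rootReflection n k * rootReflection n l =
      1 - corootSmulRoot n k k - corootSmulRoot n l l + cartan n k l • corootSmulRoot n k l := by
    simp only [rootReflection, sub_mul, mul_sub, corootSmulRoot_mul, one_mul, mul_one]
    abel
  have expand_three (k l : Fin n) (hkl : k ≠ l) :
      rootReflection n k * rootReflection n l * rootReflection n k =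
      1 - (cartan n k l * cartan n l k) • corootSmulRoot n k k - corootSmulRoot n l l +
        cartan n k l • corootSmulRoot n k l + cartan n l k • corootSmulRoot n l k := by
    rw [expand, rootReflection]
    simp only [sub_mul, mul_sub, add_mul, corootSmulRoot_mul, one_mul, mul_one, smul_mul_assoc,
      smul_smul]
    rw [show cartan n k k = 2 by simp [cartan], two_smul]
    abel
  rw [coxMatrix_apply]
  split_ifs with h1 h2 h3
  · rw [pow_one, h1, rootReflection_mul_self]
  · have hne : i ≠ j := h1
    have hc : cartan n i j * cartan n j i = 2 := by
      simp only [cartan, Fin.ext_iff]; split_ifs <;> first | rfl | omega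
    have e3 := expand_three i j hne
    have e4 : rootReflection n i * rootReflection n j * rootReflection n i * rootReflection n j =
        rootReflection n j * (rootReflection n i * rootReflection n j * rootReflection n i) := by
      rw [e3, hc]
      have hc' : cartan n j i * cartan n i j = 2 := by rw [mul_comm, hc]
      simp only [rootReflection, sub_mul, mul_sub, add_mul, mul_add, corootSmulRoot_mul, one_mul,
        mul_one, smul_mul_assoc, mul_smul_comm, smul_smul, hc',
        show cartan n j j = 2 by simp [cartan]]
      match_scalars <;> linarith
    set a := rootReflection n i
    set b := rootReflection n j
    calc (a * b) ^ 4 = a * b * a * b * (a * b * a * b) := by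
          simp only [pow_succ, pow_zero, one_mul, mul_assoc]
      _ = a * b * a * (b * b) * (a * b * a) := by rw [e4]; nth_rw 1 [← e4]; simp only [mul_assoc]
      _ = 1 := by
        rw [sj, mul_one, mul_assoc (a * b), ← mul_assoc a (a * b), ← mul_assoc a a, si, one_mul,
          mul_assoc a, ← mul_assoc b b, sj, one_mul, si]
  · have hne : i ≠ j := h1
    have hc1 : cartan n i j = -1 := by
      simp only [cartan, Fin.ext_iff]; split_ifs <;> first | rfl | omega
    have hc2 : cartan n j i = -1 := by
      simp only [cartan, Fin.ext_iff]; split_ifs <;> first | rfl | omega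
    have e3 : rootReflection n i * rootReflection n j * rootReflection n i =
        rootReflection n j * rootReflection n i * rootReflection n j := by
      rw [expand_three i j hne, expand_three j i hne.symm, hc1, hc2]
      simp only [mul_neg, mul_one, neg_neg, one_smul, neg_smul]
      abel
    set a := rootReflection n i
    set b := rootReflection n j
    calc (a * b) ^ 3 = (a * b * a) * (b * a * b) := by
          simp only [pow_succ, pow_zero, one_mul, mul_assoc]
      _ = 1 := by
        rw [← e3, mul_assoc (a * b), ← mul_assoc a (a * b), ← mul_assoc a a, si, one_mul,
          mul_assoc a, ← mul_assoc b b, sj, one_mul, si]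
  · have hc1 : cartan n i j = 0 := by
      simp only [cartan, Fin.ext_iff]; rw [Fin.ext_iff] at h1; split_ifs <;> first | rfl | omega
    have hc2 : cartan n j i = 0 := by
      simp only [cartan, Fin.ext_iff]; rw [Fin.ext_iff] at h1; split_ifs <;> first | rfl | omega
    have e2 : rootReflection n i * rootReflection n j =
        rootReflection n j * rootReflection n i := by
      rw [expand, expand, hc1, hc2]
      simp only [zero_smul]
      abel
    rw [pow_two]
    nth_rw 2 [e2]
    rw [mul_assoc, ← mul_assoc (rootReflection n j), sj, one_mul, si]

variable {n : ℕ} {W : Type*} [Group W] (cs : CoxeterSystem (coxMatrix n) W)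

/-- The relations bound the order by divisibility. As 2 and 3 are prime and 4 is a prime power, it
remains to see that `s_i s_j`, respectively its square, is nontrivial: it sends the `j`-th simple
root to a vector with `j`-th coordinate `-1`. -/
theorem orderOf_simple_mul_simple (i j : Fin n) :
    orderOf (cs.simple i * cs.simple j) = coxMatrix n i j := by
  have hpow := cs.simple_mul_simple_pow i j
  by_cases hij : i = j
  · subst hij
    rw [cs.simple_mul_simple_self, orderOf_one, (coxMatrix n).diagonal]
  have self (i : Fin n) : cartan n i i = 2 := by simp [cartan]
  let f := cs.lift ⟨_, rootReflection_isLiftable n⟩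
  have hf (i : Fin n) : f (cs.simple i) = rootReflection n i :=
    cs.lift_apply_simple (rootReflection_isLiftable n) i
  have hne : cs.simple i * cs.simple j ≠ 1 := by
    intro h
    have h := congrArg (fun w => f w (Finsupp.single j 1) j) h
    simp only [map_mul, hf, map_one, Module.End.mul_apply, rootReflection_single, self, map_sub,
      map_smul, Module.End.one_apply, Finsupp.sub_apply, Finsupp.smul_apply,
      Finsupp.single_eq_same, Finsupp.single_eq_of_ne (Ne.symm hij)] at h
    simp at h
  rw [coxMatrix_apply, if_neg hij] at hpow ⊢
  split_ifs at hpow ⊢ with h2 h3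
  · refine orderOf_eq_prime_pow (p := 2) (n := 1) ?_ hpow
    intro h
    have hc : cartan n i j * cartan n j i = 2 := by
      simp only [cartan, Fin.ext_iff]; split_ifs <;> first | rfl | omega
    have h := congrArg (fun w => f w (Finsupp.single j 1) j) h
    simp only [pow_one, pow_two, map_mul, hf, map_one, Module.End.mul_apply, rootReflection_single,
      self, map_sub, map_smul, Module.End.one_apply, Finsupp.sub_apply, Finsupp.smul_apply,
      Finsupp.single_eq_same, Finsupp.single_eq_of_ne (Ne.symm hij), smul_eq_mul] at h
    linarith
  · exact orderOf_eq_prime hpow hne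
  · exact orderOf_eq_prime hpow hne

theorem coxMatrix_ne_zero (n : ℕ) (i j : Fin n) : coxMatrix n i j ≠ 0 := by
  rw [coxMatrix_apply]
  split_ifs <;> simp

end Orders

/-! ### Expansion of a product of factors `h_i(t)` -/

section Expansion

theorem finRange_filter_eq_append {N : ℕ} (p : Fin N → Prop) [DecidablePred p] (m : Fin N)
    (hm : p m) (hp : ∀ k, p k → k ≤ m) :
    (List.finRange N).filter p = (List.finRange N).filter (fun k => p k ∧ k < m) ++ [m] := by
  have hs : (List.finRange N).Pairwise (· < ·) := List.pairwise_lt_finRange N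
  have h1 : ((List.finRange N).filter (fun k => p k ∧ k < m) ++ [m]).Pairwise (· < ·) := by
    rw [List.pairwise_append]
    refine ⟨hs.filter _, List.pairwise_singleton _ _, fun a ha b hb => ?_⟩
    simp only [List.mem_filter, decide_eq_true_eq, List.mem_singleton] at ha hb
    rw [hb]
    exact ha.2.2
  refine List.Perm.eq_of_pairwise (le := (· < ·)) (fun a b _ _ h h' => absurd h h'.asymm)
    (hs.filter _) h1 ?_
  rw [List.perm_ext_iff_of_nodup ((List.nodup_finRange N).filter _) (h1.imp fun h => h.ne)]
  intro k
  simp only [List.mem_filter, List.mem_finRange, true_and, decide_eq_true_eq, List.mem_append,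
    List.mem_singleton]
  constructor
  · intro hk
    obtain h | h := (hp k hk).lt_or_eq
    · exact Or.inl ⟨hk, h⟩
    · exact Or.inr h
  · rintro (h | rfl)
    · exact h.1
    · exact hm

variable {B : Type*} {M : CoxeterMatrix B} {W : Type*} [Group W] (cs : CoxeterSystem M W)
variable {R : Type*} [CommRing R] (β : R) (Δ : List B) (t : Fin Δ.length → R)

theorem subword_insert {J : Finset (Fin Δ.length)} {m : Fin Δ.length} (hJ : ∀ k ∈ J, k < m) :
    subword Δ (insert m J) = subword Δ J ++ [Δ.get m] := by
  rw [subword, finRange_filter_eq_append (fun k => k ∈ insert m J) m (Finset.mem_insert_self _ _),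
    List.map_append, List.map_singleton, subword]
  · congr 3
    funext k
    simp only [Finset.mem_insert, decide_eq_decide]
    constructor
    · rintro ⟨rfl | h, h'⟩
      · exact absurd h' (lt_irrefl _)
      · exact h
    · exact fun h => ⟨Or.inr h, hJ k h⟩
  · intro k hk
    obtain rfl | h := Finset.mem_insert.1 hk
    · exact le_rfl
    · exact (hJ k h).le

theorem length_subword (J : Finset (Fin Δ.length)) : (subword Δ J).length = J.card := by
  rw [subword, List.length_map, ← List.toFinset_card_of_nodup ((List.nodup_finRange _).filter _)]
  congr 1
  ext k
  simp

/-- The weight of a set of positions, where only the backward movable positions below `m` are taken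
into account. -/
noncomputable def partialWeight (m : ℕ) (J : Finset (Fin Δ.length)) : R :=
  (∏ k ∈ J, t k) * ∏ k ∈ (backward cs Δ J).filter (fun k : Fin Δ.length => (k : ℕ) < m), (1 + β * t k)

variable (hM : ∀ i j, orderOf (cs.simple i * cs.simple j) = M i j) (hM0 : ∀ i j, M i j ≠ 0)

include hM hM0

theorem mem_backward_of_forall_lt {J : Finset (Fin Δ.length)} {m : Fin Δ.length}
    (hJ : ∀ k ∈ J, k < m) :
    m ∈ backward cs Δ J ↔ cs.IsRightDescent (cs.wordProd (subword Δ J)) (Δ.get m) := by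
  simp only [backward, Finset.mem_filter, Finset.mem_univ, true_and]
  rw [Finset.filter_true_of_mem hJ, isDemazure_simple_iff cs hM hM0]
  exact and_iff_right fun h => lt_irrefl _ (hJ m h)

-- Whether an earlier position is backward movable depends only on the letters selected before it,
-- and `m`, once selected, is not movable.
omit hM hM0 in
theorem backward_insert_filter {J : Finset (Fin Δ.length)} {m : Fin Δ.length} :
    (backward cs Δ (insert m J)).filter (fun k : Fin Δ.length => (k : ℕ) < m + 1) =
      (backward cs Δ J).filter (fun k : Fin Δ.length => (k : ℕ) < m) := by
  ext k
  simp only [backward, Finset.mem_filter, Finset.mem_univ, true_and, Finset.mem_insert, not_or]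
  by_cases hk : (k : ℕ) < m
  · have h1 : (insert m J).filter (fun l => l < k) = J.filter (fun l => l < k) := by
      rw [Finset.filter_insert, if_neg (by rw [Fin.lt_def]; omega)]
    have h2 : k ≠ m := fun h => by rw [h] at hk; omega
    rw [h1]
    simp [hk, h2, Nat.lt_succ_of_lt hk]
  · constructor
    · rintro ⟨⟨⟨h, -⟩, -⟩, h'⟩
      exact absurd (Fin.ext (by omega)) h
    · exact fun h => absurd h.2 hk

/-- Multiplying the summand of `J` by the next factor splits it into the summands of `J` and of
`insert m J`. -/
theorem partialWeight_smul_mul_h {J : Finset (Fin Δ.length)} {m : Fin Δ.length}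
    (hJ : ∀ k ∈ J, k < m) :
    (if J.card = cs.length (cs.wordProd (subword Δ J)) then
        partialWeight cs β Δ t m J • uW β cs (cs.wordProd (subword Δ J)) else 0) *
      h M β (Δ.get m) (t m) =
    (if J.card = cs.length (cs.wordProd (subword Δ J)) then
        partialWeight cs β Δ t (m + 1) J • uW β cs (cs.wordProd (subword Δ J)) else 0) +
    (if (insert m J).card = cs.length (cs.wordProd (subword Δ (insert m J))) then
        partialWeight cs β Δ t (m + 1) (insert m J) •
          uW β cs (cs.wordProd (subword Δ (insert m J))) else 0) := by
  have hm : m ∉ J := fun h => lt_irrefl _ (hJ m h)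
  have hlen := length_subword Δ J
  have hle := cs.length_wordProd_le (subword Δ J)
  rw [subword_insert Δ hJ, Finset.card_insert_of_notMem hm, cs.wordProd_append,
    cs.wordProd_singleton]
  have hstep := cs.length_mul_simple (cs.wordProd (subword Δ J)) (Δ.get m)
  have hb := mem_backward_of_forall_lt cs Δ hM hM0 hJ
  have hlt : (backward cs Δ J).filter (fun k : Fin Δ.length => (k : ℕ) < m + 1) =
      if m ∈ backward cs Δ J then insert m ((backward cs Δ J).filter (fun k : Fin Δ.length => (k : ℕ) < m))
      else (backward cs Δ J).filter (fun k : Fin Δ.length => (k : ℕ) < m) := by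
    ext k
    split_ifs with hmb
    · simp only [Finset.mem_filter, Finset.mem_insert, Fin.ext_iff]
      constructor
      · rintro ⟨h, h'⟩
        by_cases e : (k : ℕ) = m
        · exact Or.inl e
        · exact Or.inr ⟨h, by omega⟩
      · rintro (h | h)
        · exact ⟨by rw [Fin.ext h]; exact hmb, by omega⟩
        · exact ⟨h.1, by omega⟩
    · simp only [Finset.mem_filter]
      refine and_congr_right fun h => ⟨fun h' => ?_, fun h' => by omega⟩
      have : k ≠ m := fun e => hmb (e ▸ h)
      have := Fin.val_ne_of_ne this
      omega
  by_cases hred : J.card = cs.length (cs.wordProd (subword Δ J))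
  · rw [if_pos hred, if_pos hred]
    -- At a descent `insert m J` is not reduced and `J` gains the factor `1 + β t`; at an ascent `m`
    -- is not movable and both sets contribute.
    by_cases hd : cs.IsRightDescent (cs.wordProd (subword Δ J)) (Δ.get m)
    · have := cs.isRightDescent_iff.1 hd
      rw [if_neg (by omega), add_zero, h, mul_add, mul_one, mul_smul_comm, smul_mul_assoc,
        uW_mul_u_of_isRightDescent β cs hM hM0 hd, partialWeight, partialWeight, hlt,
        if_pos (hb.2 hd), Finset.prod_insert (by simp)]
      module
    · have := cs.not_isRightDescent_iff.1 hd
      rw [if_pos (by omega), h, mul_add, mul_one, mul_smul_comm, smul_mul_assoc,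
        uW_mul_u_of_not_isRightDescent β cs hM hM0 hd, partialWeight, partialWeight, partialWeight,
        hlt, if_neg (fun h => hd (hb.1 h)), backward_insert_filter, Finset.prod_insert hm]
      module
  -- A non-reduced subword stays non-reduced after appending a letter, so every summand is zero.
  · rw [if_neg hred, if_neg hred, if_neg (by omega), zero_mul, add_zero]

theorem prod_filter_h_eq (m : ℕ) (hm : m ≤ Δ.length) :
    (((List.finRange Δ.length).filter fun k : Fin Δ.length => (k : ℕ) < m).map
      fun k => h M β (Δ.get k) (t k)).prod =
    ∑ J ∈ (Finset.univ.filter fun k : Fin Δ.length => (k : ℕ) < m).powerset,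
      if J.card = cs.length (cs.wordProd (subword Δ J)) then
        partialWeight cs β Δ t m J • uW β cs (cs.wordProd (subword Δ J)) else 0 := by
  induction m with
  | zero => simp [subword, partialWeight, uW_one β cs hM hM0]
  | succ m ih =>
    have e1 : (Finset.univ.filter fun k : Fin Δ.length => (k : ℕ) < m + 1) =
        insert ⟨m, hm⟩ (Finset.univ.filter fun k : Fin Δ.length => (k : ℕ) < m) := by
      ext k
      simp only [Finset.mem_filter, Finset.mem_univ, true_and, Finset.mem_insert, Fin.ext_iff]
      omega
    rw [e1, Finset.sum_powerset_insert (by simp), ← Finset.sum_add_distrib,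
      finRange_filter_eq_append (fun k : Fin Δ.length => (k : ℕ) < m + 1) ⟨m, hm⟩ (by simp)
        (fun k hk => by rw [Fin.le_def]; simp only; omega),
      List.map_append, List.prod_append, List.map_singleton, List.prod_singleton]
    have e2 : (fun k : Fin Δ.length => decide ((k : ℕ) < m + 1 ∧ k < ⟨m, hm⟩)) =
        fun k : Fin Δ.length => decide ((k : ℕ) < m) := by
      funext k
      rw [decide_eq_decide, Fin.lt_def]
      simp only
      omega
    rw [e2, ih (by omega), Finset.sum_mul]
    refine Finset.sum_congr rfl fun J hJ => ?_
    refine partialWeight_smul_mul_h cs β Δ t hM hM0 (m := ⟨m, hm⟩) fun k hk => ?_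
    have := Finset.mem_powerset.1 hJ hk
    simpa [Fin.lt_def] using this

/-- The expansion of a product of factors `h_i(t)` with respect to the basis `u_w`. -/
theorem isExpansion_prod_h :
    IsExpansion β cs ((List.finRange Δ.length).map fun k => h M β (Δ.get k) (t k)).prod
      (∑ J : Finset (Fin Δ.length), if J.card = cs.length (cs.wordProd (subword Δ J)) then
        Finsupp.single (cs.wordProd (subword Δ J))
          ((∏ k ∈ J, t k) * ∏ k ∈ backward cs Δ J, (1 + β * t k)) else 0) := by
  have h := prod_filter_h_eq cs β Δ t hM hM0 Δ.length le_rfl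
  simp only [Fin.is_lt, decide_true, List.filter_true, Finset.filter_true, Finset.powerset_univ,
    partialWeight] at h
  rw [IsExpansion, h]
  change _ = Finsupp.linearCombination R (uW β cs) _
  rw [map_sum]
  refine Finset.sum_congr rfl fun J _ => ?_
  split_ifs with hJ
  · rw [Finsupp.linearCombination_single]
  · rw [map_zero]

theorem coeff_prod_h (w : W) :
    coeff β cs ((List.finRange Δ.length).map fun k => h M β (Δ.get k) (t k)).prod w =
      ∑ J ∈ Rsub cs Δ w, (∏ k ∈ J, t k) * ∏ k ∈ backward cs Δ J, (1 + β * t k) := by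
  classical
  rw [coeff_eq β cs hM (isExpansion_prod_h cs β Δ t hM hM0), Finsupp.finsetSum_apply, Rsub,
    Finset.sum_filter]
  refine Finset.sum_congr rfl fun J _ => ?_
  by_cases e : cs.wordProd (subword Δ J) = w
  · subst e
    by_cases hJ : J.card = cs.length (cs.wordProd (subword Δ J))
    · rw [if_pos hJ, if_pos ⟨rfl, hJ⟩, Finsupp.single_eq_same]
    · rw [if_neg hJ, if_neg (fun h => hJ h.2), Finsupp.zero_apply]
  · have e' : ¬ (cs.wordProd (subword Δ J) = w ∧ J.card = cs.length w) := fun h => e h.1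
    rw [if_neg e']
    split_ifs
    · exact Finsupp.single_eq_of_ne (Ne.symm e)
    · rfl

end Expansion

/-! ### Yang-Baxter equations -/

section YangBaxter

variable {R : Type*} [CommRing R] (β : R) (n : ℕ)

/-- The generator `u_i`, with the convention `u_i = 0` for `i ≥ n`. -/
def gen (i : ℕ) : IdAlg (coxMatrix n) β :=
  if hi : i < n then u (coxMatrix n) β ⟨i, hi⟩ else 0

/-- `h_i(t) = 1 + t u_i`, with the convention `u_i = 0` for `i ≥ n`. -/
def fac (i : ℕ) (t : R) : IdAlg (coxMatrix n) β := 1 + t • gen β n i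

theorem gen_mul_self (i : ℕ) : gen β n i * gen β n i = β • gen β n i := by
  unfold gen
  split_ifs
  · exact u_mul_self _ _ _
  · simp

/-- Beyond the rank both sides vanish; because of the zero convention, no later identity needs an
upper bound on the index. -/
theorem gen_comm {i j : ℕ} (hij : i + 2 ≤ j) : gen β n i * gen β n j = gen β n j * gen β n i := by
  by_cases hj : j < n
  · have hi : i < n := by omega
    have e : coxMatrix n ⟨i, hi⟩ ⟨j, hj⟩ = 2 := by
      rw [coxMatrix_apply]
      simp only [Fin.mk.injEq]
      rw [if_neg (by omega), if_neg (by omega), if_neg (by omega)]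
    have h := prod_u_braidWord (M := coxMatrix n) β ⟨i, hi⟩ ⟨j, hj⟩
    simp only [CoxeterSystem.braidWord, e, (coxMatrix n).symmetric ⟨j, hj⟩ ⟨i, hi⟩,
      CoxeterSystem.alternatingWord] at h
    simpa [gen, hi, hj] using h
  · simp [gen, hj]

theorem gen_braid_three {i : ℕ} (hi : 1 ≤ i) :
    gen β n (i + 1) * (gen β n i * gen β n (i + 1)) =
      gen β n i * (gen β n (i + 1) * gen β n i) := by
  by_cases hj : i + 1 < n
  · have hi' : i < n := by omega
    have e : coxMatrix n ⟨i, hi'⟩ ⟨i + 1, hj⟩ = 3 := by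
      rw [coxMatrix_apply, if_neg (by simp), if_neg (by simp only; omega), if_pos (Or.inl rfl)]
    have h := prod_u_braidWord (M := coxMatrix n) β ⟨i, hi'⟩ ⟨i + 1, hj⟩
    simp only [CoxeterSystem.braidWord, e, (coxMatrix n).symmetric ⟨i + 1, hj⟩ ⟨i, hi'⟩,
      CoxeterSystem.alternatingWord] at h
    simpa [gen, hi', hj, mul_assoc] using h
  · simp [gen, hj]

theorem gen_braid_four :
    gen β n 1 * (gen β n 0 * (gen β n 1 * gen β n 0)) =
      gen β n 0 * (gen β n 1 * (gen β n 0 * gen β n 1)) := by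
  by_cases hj : 1 < n
  · have hi' : 0 < n := by omega
    have e : coxMatrix n ⟨0, hi'⟩ ⟨1, hj⟩ = 4 := by
      rw [coxMatrix_apply]
      simp
    have h := prod_u_braidWord (M := coxMatrix n) β ⟨1, hj⟩ ⟨0, hi'⟩
    simp only [CoxeterSystem.braidWord, e, (coxMatrix n).symmetric ⟨1, hj⟩ ⟨0, hi'⟩,
      CoxeterSystem.alternatingWord] at h
    simpa [gen, hi', hj, mul_assoc] using h
  · simp [gen, hj]

theorem fac_mul_fac (i : ℕ) (s t : R) : fac β n i s * fac β n i t = fac β n i (oplus β s t) := by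
  simp only [fac, oplus, mul_add, add_mul, one_mul, mul_one, smul_mul_smul_comm, gen_mul_self]
  module

theorem fac_eq_h {i : ℕ} (hi : i < n) (t : R) : fac β n i t = h (coxMatrix n) β ⟨i, hi⟩ t := by
  simp [fac, gen, hi, h]

theorem fac_eq_one {i : ℕ} (hi : n ≤ i) (t : R) : fac β n i t = 1 := by
  simp [fac, gen, hi]

theorem fac_comm {i j : ℕ} (hij : i + 2 ≤ j) (s t : R) :
    Commute (fac β n i s) (fac β n j t) := by
  have h : Commute (gen β n i) (gen β n j) := gen_comm β n hij
  have h' : Commute (1 + s • gen β n i) (gen β n j) := (Commute.one_left _).add_left (h.smul_left s)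
  exact (Commute.one_right _).add_right (h'.smul_right t)

/-- The type `A` Yang-Baxter equation. -/
theorem yangBaxter {i : ℕ} (hi : 1 ≤ i) (s t : R) :
    fac β n i s * (fac β n (i + 1) (oplus β s t) * fac β n i t) =
      fac β n (i + 1) t * (fac β n i (oplus β s t) * fac β n (i + 1) s) := by
  simp only [fac, oplus, mul_add, add_mul, one_mul, mul_one, smul_mul_assoc, mul_smul_comm,
    gen_mul_self, gen_braid_three β n hi]
  module

/-- `(1 + β y) h_i(x ⊖ y)`, written without denominators. -/
def facDiff (i : ℕ) (x y : R) : IdAlg (coxMatrix n) β :=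
  (1 + β * y) • (1 : IdAlg (coxMatrix n) β) + (x - y) • gen β n i

theorem facDiff_mul_fac (i : ℕ) (x y : R) :
    facDiff β n i x y * fac β n i y = (1 + β * y) • fac β n i x := by
  simp only [fac, facDiff, mul_add, add_mul, one_mul, mul_one, smul_mul_assoc, mul_smul_comm,
    gen_mul_self]
  module

theorem fac_mul_facDiff (i : ℕ) (x y : R) :
    fac β n i y * facDiff β n i x y = (1 + β * y) • fac β n i x := by
  simp only [fac, facDiff, mul_add, add_mul, one_mul, mul_one, smul_mul_assoc, mul_smul_comm,
    gen_mul_self]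
  module

/-- The Yang-Baxter equation with arguments `x ⊖ y`, `x = (x ⊖ y) ⊕ y` and `y`, multiplied by `1 + β
y`. -/
theorem facDiff_succ_mul {i : ℕ} (hi : 1 ≤ i) (x y : R) :
    facDiff β n (i + 1) x y * (fac β n i x * fac β n (i + 1) y) =
      fac β n i y * (fac β n (i + 1) x * facDiff β n i x y) := by
  simp only [fac, facDiff, mul_add, add_mul, one_mul, mul_one, smul_mul_assoc, mul_smul_comm,
    gen_mul_self, gen_braid_three β n hi]
  module

theorem facDiff_mul_succ {i : ℕ} (hi : 1 ≤ i) (x y : R) :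
    facDiff β n i x y * (fac β n (i + 1) x * fac β n i y) =
      fac β n (i + 1) y * (fac β n i x * facDiff β n (i + 1) x y) := by
  simp only [fac, facDiff, mul_add, add_mul, one_mul, mul_one, smul_mul_assoc, mul_smul_comm,
    gen_mul_self, gen_braid_three β n hi]
  module

/-- The argument of the middle factor `h_0` of `F^X(t)`. -/
def midArg (X : Kind) (t : R) : R :=
  match X with
  | Kind.B => t
  | Kind.C => oplus β t t

/-- The type `B_2 = C_2` Yang-Baxter equation. -/
theorem facDiff_one_mul (X : Kind) (x y : R) :
    facDiff β n 1 x y * (fac β n 0 (midArg β X x) *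
      (fac β n 1 (oplus β x y) * fac β n 0 (midArg β X y))) =
    fac β n 0 (midArg β X y) * (fac β n 1 (oplus β x y) *
      (fac β n 0 (midArg β X x) * facDiff β n 1 x y)) := by
  -- The quadratic relation inside right-nested words, so that every word reaches normal form.
  have h0 (i : ℕ) (w : IdAlg (coxMatrix n) β) :
      gen β n i * (gen β n i * w) = β • (gen β n i * w) := by
    rw [← mul_assoc, gen_mul_self, smul_mul_assoc]
  cases X <;>
  · simp only [fac, facDiff, midArg, oplus, mul_add, add_mul, one_mul, mul_one, smul_mul_assoc,
      mul_smul_comm, gen_mul_self, gen_braid_four β n, h0]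
    module

/-- The factors of index at most `k` of `F^X(t)`:
`h_k(t) ⋯ h_1(t) h_0 h_1(t) ⋯ h_k(t)`. -/
def partialF (X : Kind) : ℕ → R → IdAlg (coxMatrix n) β
  | 0, t => fac β n 0 (midArg β X t)
  | k + 1, t => fac β n (k + 1) t * (partialF X k t * fac β n (k + 1) t)

theorem commute_partialF_fac (X : Kind) {k j : ℕ} (hkj : k + 2 ≤ j) (s t : R) :
    Commute (partialF β n X k s) (fac β n j t) := by
  induction k with
  | zero => exact fac_comm β n hkj _ _
  | succ k ih =>
    have h1 := fac_comm β n (show k + 1 + 2 ≤ j from hkj) s t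
    exact h1.mul_left ((ih (by omega)).mul_left h1)

/-- The `B_2` equation is the base. One step up, type `A` moves carry the outer factors past each
other, since `partialF` at level `k` commutes with `h_{k+2}`, leaving the identity of level `k` in
the middle. -/
theorem facDiff_mul_partialF (X : Kind) (k : ℕ) (x y : R) :
    facDiff β n (k + 1) x y * (partialF β n X k x *
      (fac β n (k + 1) (oplus β x y) * partialF β n X k y)) =
    partialF β n X k y * (fac β n (k + 1) (oplus β x y) *
      (partialF β n X k x * facDiff β n (k + 1) x y)) := by
  induction k with
  | zero => exact facDiff_one_mul β n X x y
  | succ k ih =>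
    have c (s t : R) := (commute_partialF_fac β n X (show k + 2 ≤ k + 1 + 1 by omega) s t).eq
    have hk : 1 ≤ k + 1 := by omega
    have y1 := yangBaxter β n hk x y
    have y2 := yangBaxter β n hk y x
    have hxy : oplus β y x = oplus β x y := by simp only [oplus]; ring
    rw [hxy] at y2
    have m1 := facDiff_succ_mul β n hk x y
    have m2 := facDiff_mul_succ β n hk x y
    simp only [partialF]
    have cxy := c x y
    have cyx := c y x
    have cyy := c y y
    have cxx := c x x
    generalize fac β n (k + 1 + 1) (oplus β x y) = Bz at *
    generalize fac β n (k + 1) (oplus β x y) = Az at *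
    generalize fac β n (k + 1) x = Ax at *
    generalize fac β n (k + 1) y = Ay at *
    generalize fac β n (k + 1 + 1) x = Bx at *
    generalize fac β n (k + 1 + 1) y = By at *
    generalize facDiff β n (k + 1) x y = gA at *
    generalize facDiff β n (k + 1 + 1) x y = gB at *
    generalize partialF β n X k x = Kx at *
    generalize partialF β n X k y = Ky at *
    calc gB * (Ax * (Kx * Ax) * (Bz * (Ay * (Ky * Ay))))
        = gB * (Ax * (Kx * ((Ax * (Bz * Ay)) * (Ky * Ay)))) := by simp only [mul_assoc]
      _ = gB * (Ax * ((Kx * By) * (Az * ((Bx * Ky) * Ay)))) := by rw [y1]; simp only [mul_assoc]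
      _ = (gB * (Ax * By)) * (Kx * (Az * (Ky * (Bx * Ay)))) := by
        rw [cxy, ← cyx]; simp only [mul_assoc]
      _ = Ay * (Bx * ((gA * (Kx * (Az * Ky))) * (Bx * Ay))) := by rw [m1]; simp only [mul_assoc]
      _ = Ay * (Bx * (Ky * (Az * (Kx * (gA * (Bx * Ay)))))) := by rw [ih]; simp only [mul_assoc]
      _ = Ay * ((Bx * Ky) * (Az * ((Kx * By) * (Ax * gB)))) := by rw [m2]; simp only [mul_assoc]
      _ = Ay * (Ky * ((Bx * (Az * By)) * (Kx * (Ax * gB)))) := by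
        rw [cxy, ← cyx]; simp only [mul_assoc]
      _ = Ay * (Ky * Ay) * (Bz * (Ax * (Kx * Ax) * gB)) := by rw [← y2]; simp only [mul_assoc]

/-- The scalar turns `h(x)` into `h(y)` times `facDiff`, the inner `h(x) h(y)` fuse to `h(x ⊕ y)`,
and `facDiff` crosses to the other end, where it is reabsorbed. -/
theorem smul_partialF_mul_partialF (X : Kind) (k : ℕ) (x y : R) :
    (1 + β * y) • (partialF β n X k x * partialF β n X k y) =
      (1 + β * y) • (partialF β n X k y * partialF β n X k x) := by
  cases k with
  | zero =>
    simp only [partialF, fac_mul_fac]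
    congr 2
    simp only [oplus]
    ring
  | succ k =>
    have e := facDiff_mul_partialF β n X k x y
    have m1 := facDiff_mul_fac β n (k + 1) x y
    have m2 := fac_mul_facDiff β n (k + 1) x y
    have a1 := fac_mul_fac β n (k + 1) x y
    have a2 := fac_mul_fac β n (k + 1) y x
    have hxy : oplus β y x = oplus β x y := by simp only [oplus]; ring
    rw [hxy] at a2
    simp only [partialF]
    generalize fac β n (k + 1) (oplus β x y) = Az at *
    generalize fac β n (k + 1) x = Ax at *
    generalize fac β n (k + 1) y = Ay at *
    generalize facDiff β n (k + 1) x y = g at *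
    generalize partialF β n X k x = Kx at *
    generalize partialF β n X k y = Ky at *
    calc (1 + β * y) • (Ax * (Kx * Ax) * (Ay * (Ky * Ay)))
        = ((1 + β * y) • Ax) * (Kx * ((Ax * Ay) * (Ky * Ay))) := by
          simp only [mul_assoc, smul_mul_assoc]
      _ = Ay * ((g * (Kx * (Az * Ky))) * Ay) := by rw [← m2, a1]; simp only [mul_assoc]
      _ = Ay * (Ky * (Az * (Kx * (g * Ay)))) := by rw [e]; simp only [mul_assoc]
      _ = _ := by rw [m1, ← a2]; simp only [mul_assoc, mul_smul_comm]

end YangBaxter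

/-! ### Base change and the commutation of the elements `F^X(t)` -/

section BaseChange

/-- The map of idCoxeter algebras induced by a ring homomorphism. -/
noncomputable def baseChange {B : Type*} (M : CoxeterMatrix B) {S R : Type*} [CommRing S]
    [CommRing R] (φ : S →+* R) (β : S) : IdAlg M β →+* IdAlg M (φ β) :=
  letI : Algebra S (IdAlg M (φ β)) := Algebra.compHom _ φ
  (RingQuot.liftAlgHom S ⟨FreeAlgebra.lift S (u M (φ β)), by
    intro a b hab
    cases hab with
    | sq i =>
      rw [map_mul, map_smul, FreeAlgebra.lift_ι_apply]
      exact u_mul_self M (φ β) i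
    | braid i j =>
      simp only [map_list_prod, List.map_map, Function.comp_def, FreeAlgebra.lift_ι_apply]
      exact prod_u_braidWord (φ β) i j⟩ : IdAlg M β →ₐ[S] IdAlg M (φ β)).toRingHom

variable {S R : Type*} [CommRing S] [CommRing R] (φ : S →+* R) (β : S)

theorem baseChange_u {B : Type*} (M : CoxeterMatrix B) (i : B) :
    baseChange M φ β (u M β i) = u M (φ β) i := by
  let : Algebra S (IdAlg M (φ β)) := Algebra.compHom _ φ
  simp [baseChange, u]

theorem baseChange_smul {B : Type*} (M : CoxeterMatrix B) (r : S) (g : IdAlg M β) :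
    baseChange M φ β (r • g) = φ r • baseChange M φ β g := by
  let : Algebra S (IdAlg M (φ β)) := Algebra.compHom _ φ
  exact map_smul (RingQuot.liftAlgHom S _ : IdAlg M β →ₐ[S] IdAlg M (φ β)) r g

theorem baseChange_fac (n : ℕ) (i : ℕ) (t : S) :
    baseChange (coxMatrix n) φ β (fac β n i t) = fac (φ β) n i (φ t) := by
  rw [fac, map_add, map_one, baseChange_smul, fac, gen, gen]
  split_ifs
  · rw [baseChange_u]
  · rw [map_zero]

theorem baseChange_partialF (n : ℕ) (X : Kind) (k : ℕ) (t : S) :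
    baseChange (coxMatrix n) φ β (partialF β n X k t) = partialF (φ β) n X k (φ t) := by
  induction k with
  | zero => cases X <;> simp [partialF, baseChange_fac, midArg, oplus]
  | succ k ih => rw [partialF, map_mul, map_mul, ih, baseChange_fac, partialF]

/-- The identity is the specialization of one over `ℤ[β, x, y]`, where `1 + β y` is not a zero
divisor and the algebra is torsion-free. -/
theorem commute_partialF {R : Type*} [CommRing R] (β : R) (n : ℕ) (X : Kind) (k : ℕ) (x y : R) :
    Commute (partialF β n X k x) (partialF β n X k y) := by
  obtain ⟨φ, h0, h1, h2⟩ : ∃ φ : MvPolynomial (Fin 3) ℤ →+* R, φ (MvPolynomial.X 0) = β ∧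
      φ (MvPolynomial.X 1) = x ∧ φ (MvPolynomial.X 2) = y :=
    ⟨MvPolynomial.eval₂Hom (Int.castRingHom R) ![β, x, y], MvPolynomial.eval₂Hom_X' _ _ _,
      MvPolynomial.eval₂Hom_X' _ _ _, MvPolynomial.eval₂Hom_X' _ _ _⟩
  have generic : Commute (partialF (MvPolynomial.X 0 : MvPolynomial (Fin 3) ℤ) n X k (MvPolynomial.X 1))
      (partialF (MvPolynomial.X 0 : MvPolynomial (Fin 3) ℤ) n X k (MvPolynomial.X 2)) := by
    have e := smul_partialF_mul_partialF (MvPolynomial.X 0 : MvPolynomial (Fin 3) ℤ) n X k (MvPolynomial.X 1)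
      (MvPolynomial.X 2)
    refine eq_of_smul_eq_smul _ (coxMatrix n).toCoxeterSystem (orderOf_simple_mul_simple _)
      (coxMatrix_ne_zero n) (mem_nonZeroDivisors_of_ne_zero ?_) e
    intro h
    -- The polynomial `1 + β y` takes the value 1 at the origin, so it is nonzero.
    have := congrArg (MvPolynomial.eval (0 : Fin 3 → ℤ)) h
    simp at this
  have := generic.map (baseChange (coxMatrix n) φ (MvPolynomial.X 0))
  rw [baseChange_partialF, baseChange_partialF, h1, h2] at this
  rw [← h0]
  exact this

end BaseChange

/-! ### Factorization of the generating function -/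

/-! ### Products over lists and ranges. -/

section Lists

variable {A : Type*} [Monoid A]

theorem finRange_filter_le_eq_cons {n i : ℕ} (hi : i < n) :
    (List.finRange n).filter (fun k : Fin n => i ≤ (k : ℕ)) =
      ⟨i, hi⟩ :: (List.finRange n).filter (fun k : Fin n => i + 1 ≤ (k : ℕ)) := by
  have hs : (List.finRange n).Pairwise (· < ·) := List.pairwise_lt_finRange n
  have h1 : (⟨i, hi⟩ :: (List.finRange n).filter
      (fun k : Fin n => i + 1 ≤ (k : ℕ))).Pairwise (· < ·) := by
    rw [List.pairwise_cons]
    refine ⟨fun b hb => ?_, hs.filter _⟩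
    simp only [List.mem_filter, decide_eq_true_eq] at hb
    rw [Fin.lt_def]
    exact hb.2
  refine List.Perm.eq_of_pairwise (le := (· < ·)) (fun a b _ _ h h' => absurd h h'.asymm)
    (hs.filter _) h1 ?_
  rw [List.perm_ext_iff_of_nodup ((List.nodup_finRange n).filter _) (h1.imp fun h => h.ne)]
  intro k
  simp only [List.mem_filter, List.mem_finRange, true_and, decide_eq_true_eq, List.mem_cons,
    Fin.ext_iff]
  omega

theorem prod_map_flatMap {α γ : Type*} (l : List α) (f : α → List γ) (g : γ → A) :
    ((l.flatMap f).map g).prod = (l.map fun a => ((f a).map g).prod).prod := by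
  induction l with
  | nil => rfl
  | cons a l ih => simp [ih]

theorem prod_map_range_eq_of_le {f : ℕ → A} {m m' : ℕ} (h : m ≤ m') (hf : ∀ i, m ≤ i → f i = 1) :
    ((List.range m').map f).prod = ((List.range m).map f).prod := by
  induction m', h using Nat.le_induction with
  | base => rfl
  | succ k hk ih => simp [List.range_succ, ih, hf k hk]

theorem prod_map_finRange (n : ℕ) (f : ℕ → A) :
    ((List.finRange n).map fun i : Fin n => f i).prod = ((List.range n).map f).prod := by
  rw [← List.map_coe_finRange_eq_range, List.map_map]
  rfl

theorem prod_map_reverse_range (n : ℕ) (f : ℕ → A) :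
    ((List.range n).reverse.map f).prod = ((List.range n).map fun i => f (n - 1 - i)).prod := by
  congr 1
  refine List.ext_getElem (by simp) fun i h1 h2 => ?_
  simp

theorem prod_map_reverse_range_succ (n : ℕ) (f : ℕ → A) :
    ((List.range (n + 1)).reverse.map f).prod = f n * ((List.range n).reverse.map f).prod := by
  simp [List.range_succ]

end Lists

section Factorization

variable {R : Type*} [CommRing R] (β : R) (n : ℕ)

theorem h_eq_fac (k : Fin n) (t : R) : h (coxMatrix n) β k t = fac β n k t :=
  (fac_eq_h β n k.2 t).symm

theorem Adesc_eq (i : ℕ) (t : R) : Adesc β n i t = Adesc β n (i + 1) t * fac β n i t := by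
  by_cases hi : i < n
  · rw [Adesc, finRange_filter_le_eq_cons hi, fac_eq_h β n hi]
    simp [Adesc]
  · rw [fac_eq_one β n (by omega), mul_one, Adesc, Adesc]
    congr 4
    funext k
    rw [decide_eq_decide]
    omega

theorem Aasc_eq (i : ℕ) (t : R) : Aasc β n i t = fac β n i t * Aasc β n (i + 1) t := by
  by_cases hi : i < n
  · rw [Aasc, finRange_filter_le_eq_cons hi, fac_eq_h β n hi]
    simp [Aasc]
  · rw [fac_eq_one β n (by omega), one_mul, Aasc, Aasc]
    congr 3
    funext k
    rw [decide_eq_decide]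
    omega

theorem filter_le_eq_nil {i : ℕ} (hi : n ≤ i) :
    (List.finRange n).filter (fun k : Fin n => i ≤ (k : ℕ)) = [] := by
  rw [List.filter_eq_nil_iff]
  intro k _
  simp only [decide_eq_true_eq]
  omega

theorem Adesc_eq_one {i : ℕ} (hi : n ≤ i) (t : R) : Adesc β n i t = 1 := by
  simp [Adesc, filter_le_eq_nil n hi]

theorem Aasc_eq_one {i : ℕ} (hi : n ≤ i) (t : R) : Aasc β n i t = 1 := by
  simp [Aasc, filter_le_eq_nil n hi]

/-- Downward induction from the indices `i ≥ n` to a lower bound `m`. -/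
theorem downward_induction {P : ℕ → Prop} {m : ℕ} (base : ∀ i, n ≤ i → P i)
    (step : ∀ i, m ≤ i → P (i + 1) → P i) (i : ℕ) (hi : m ≤ i) : P i := by
  induction hk : n - i generalizing i with
  | zero => exact base i (by omega)
  | succ k ih => exact step i hi (ih (i + 1) (by omega) (by omega))

theorem commute_fac_Adesc {i j : ℕ} (hij : i + 2 ≤ j) (s t : R) :
    Commute (fac β n i s) (Adesc β n j t) := by
  refine downward_induction n (P := fun j => Commute (fac β n i s) (Adesc β n j t)) (m := i + 2)
    (fun j hj => ?_) (fun j hj ih => ?_) j hij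
  · rw [Adesc_eq_one β n hj]
    exact Commute.one_right _
  · rw [Adesc_eq]
    exact ih.mul_right (fac_comm β n hj s t)

theorem commute_fac_Aasc {i j : ℕ} (hij : i + 2 ≤ j) (s t : R) :
    Commute (fac β n i s) (Aasc β n j t) := by
  refine downward_induction n (P := fun j => Commute (fac β n i s) (Aasc β n j t)) (m := i + 2)
    (fun j hj => ?_) (fun j hj ih => ?_) j hij
  · rw [Aasc_eq_one β n hj]
    exact Commute.one_right _
  · rw [Aasc_eq]
    exact (fac_comm β n hj s t).mul_right ih

/-- Peel off the outer factors of index `i`, use the identity for `i + 1`, bring them together by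
commutation, and apply Yang-Baxter to the resulting triple. -/
theorem Aasc_mul_Adesc {i : ℕ} (hi : 1 ≤ i) (s t : R) :
    Aasc β n i s * Adesc β n i t =
      Adesc β n (i + 1) t * fac β n i (oplus β s t) * Aasc β n (i + 1) s := by
  refine downward_induction n (P := fun i => Aasc β n i s * Adesc β n i t =
      Adesc β n (i + 1) t * fac β n i (oplus β s t) * Aasc β n (i + 1) s) (m := 1)
    (fun j hj => ?_) (fun j hj ih => ?_) i hi
  · simp [Adesc_eq_one β n hj, Aasc_eq_one β n hj, fac_eq_one β n hj,
      Adesc_eq_one β n (Nat.le_succ_of_le hj), Aasc_eq_one β n (Nat.le_succ_of_le hj)]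
  · have c1 := (commute_fac_Adesc β n (le_refl (j + 2)) s t).eq
    have c2 := (commute_fac_Aasc β n (le_refl (j + 2)) t s).eq
    have y := yangBaxter β n hj s t
    calc Aasc β n j s * Adesc β n j t
        = fac β n j s * (Aasc β n (j + 1) s * Adesc β n (j + 1) t) * fac β n j t := by
          rw [Aasc_eq, Adesc_eq]; simp only [mul_assoc]
      _ = (fac β n j s * Adesc β n (j + 2) t) * (fac β n (j + 1) (oplus β s t) *
            (Aasc β n (j + 2) s * fac β n j t)) := by rw [ih]; simp only [mul_assoc]
      _ = Adesc β n (j + 2) t * ((fac β n j s * (fac β n (j + 1) (oplus β s t) * fac β n j t)) *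
            Aasc β n (j + 2) s) := by rw [c1, ← c2]; simp only [mul_assoc]
      _ = _ := by rw [y, Adesc_eq β n (j + 1), Aasc_eq β n (j + 1)]; simp only [mul_assoc]

/-- `A_{k+1}(y_1) ⋯ A_{k+m}(y_m)`. -/
def shiftedGA (k m : ℕ) (y : ℕ → R) : IdAlg (coxMatrix n) β :=
  ((List.range m).map fun i => Adesc β n (k + i + 1) (y (i + 1))).prod

/-- `h_{k+1}(z ⊕ y_1) ⋯ h_{k+m}(z ⊕ y_m)`. -/
def row (k m : ℕ) (z : R) (y : ℕ → R) : IdAlg (coxMatrix n) β :=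
  ((List.range m).map fun i => fac β n (k + i + 1) (oplus β z (y (i + 1)))).prod

theorem commute_row_Adesc {k m j : ℕ} (h : k + m + 2 ≤ j) (z : R) (y : ℕ → R) (t : R) :
    Commute (row β n k m z y) (Adesc β n j t) := by
  refine Commute.list_prod_left _ _ fun g hg => ?_
  obtain ⟨i, hi, rfl⟩ := List.mem_map.1 hg
  rw [List.mem_range] at hi
  exact commute_fac_Adesc β n (by omega) _ _

theorem commute_fac_zero_shiftedGA {k m : ℕ} (hk : 1 ≤ k) (t : R) (y : ℕ → R) :
    Commute (fac β n 0 t) (shiftedGA β n k m y) := by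
  refine Commute.list_prod_right _ _ fun g hg => ?_
  obtain ⟨i, hi, rfl⟩ := List.mem_map.1 hg
  exact commute_fac_Adesc β n (by omega) _ _

/-- Each crossing leaves one factor of the row and raises the index of the descending product by
one; this index exceeds those of the earlier row factors by at least two, so they commute. -/
theorem Aasc_mul_shiftedGA_aux (k m : ℕ) (z : R) (y : ℕ → R) :
    Aasc β n (k + 1) z * shiftedGA β n k m y =
      shiftedGA β n (k + 1) m y * row β n k m z y * Aasc β n (k + m + 1) z := by
  induction m with
  | zero => simp [shiftedGA, row]
  | succ m ih =>
    have e1 (k : ℕ) : shiftedGA β n k (m + 1) y =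
        shiftedGA β n k m y * Adesc β n (k + m + 1) (y (m + 1)) := by
      simp [shiftedGA, List.range_succ]
    have e2 : row β n k (m + 1) z y =
        row β n k m z y * fac β n (k + m + 1) (oplus β z (y (m + 1))) := by
      simp [row, List.range_succ]
    have c := (commute_row_Adesc β n (le_refl (k + m + 2)) z y (y (m + 1))).eq
    rw [e1, ← mul_assoc, ih, mul_assoc, Aasc_mul_Adesc β n (by omega), e1, e2,
      show k + 1 + m + 1 = k + m + 2 by ring, show k + (m + 1) + 1 = k + m + 1 + 1 by ring]
    calc _ = shiftedGA β n (k + 1) m y * (row β n k m z y * Adesc β n (k + m + 2) (y (m + 1))) *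
          (fac β n (k + m + 1) (oplus β z (y (m + 1))) * Aasc β n (k + m + 1 + 1) z) := by
            simp only [mul_assoc]
      _ = _ := by rw [c]; simp only [mul_assoc]

theorem Aasc_mul_shiftedGA (k : ℕ) (z : R) (y : ℕ → R) :
    Aasc β n (k + 1) z * shiftedGA β n k n y =
      shiftedGA β n (k + 1) n y * row β n k n z y := by
  rw [Aasc_mul_shiftedGA_aux, Aasc_eq_one β n (by omega), mul_one]

/-- Superfluous factors have index at least `n` and equal 1, so a uniform length `n` can be used for
every shift. -/
theorem shiftedGA_of_le {k m m' : ℕ} (h : m ≤ m') (hm : n ≤ k + m + 1) (y : ℕ → R) :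
    shiftedGA β n k m' y = shiftedGA β n k m y :=
  prod_map_range_eq_of_le h fun i hi => Adesc_eq_one β n (by omega) _

theorem shiftedGA_eq_one (m : ℕ) (y : ℕ → R) : shiftedGA β n n m y = 1 := by
  rw [shiftedGA, prod_map_range_eq_of_le (Nat.zero_le m) fun i _ => Adesc_eq_one β n (by omega) _]
  rfl

theorem GA_eq_shiftedGA (y : ℕ → R) : GA β n y = shiftedGA β n 0 n y := by
  rw [shiftedGA_of_le β n (Nat.sub_le n 1) (by omega), GA, shiftedGA]
  simp only [zero_add]

/-! #### The inverse of `G_A` -/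

/-- The pairs `h_j(t) h_j(⊖ t)` cancel from the middle outwards. For `i ≥ n` both products are
empty, so `1 + β b_n` need not be invertible. -/
theorem Aasc_mul_Adesc_ominus {i : ℕ} {t : R} (h : i < n → IsUnit (1 + β * t)) :
    Aasc β n i t * Adesc β n i (ominus β t) = 1 := by
  by_cases hi : i < n
  · have e0 : oplus β t (ominus β t) = 0 := by
      have e := Ring.mul_inverse_cancel _ (h hi)
      simp only [oplus, ominus]
      linear_combination (-t) * e
    refine downward_induction n
      (P := fun i => Aasc β n i t * Adesc β n i (ominus β t) = 1) (m := i)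
      (fun j hj => ?_) (fun j _ ih => ?_) i le_rfl
    · rw [Adesc_eq_one β n hj, Aasc_eq_one β n hj, mul_one]
    · rw [Aasc_eq, Adesc_eq, mul_assoc, ← mul_assoc (Aasc β n (j + 1) t), ih, one_mul, fac_mul_fac,
        e0, fac, zero_smul, add_zero]
  · rw [Adesc_eq_one β n (by omega), Aasc_eq_one β n (by omega), mul_one]

theorem prod_Aasc_mul_shiftedGA_ominus (b : ℕ → R)
    (hb : ∀ j, 1 ≤ j → j < n → IsUnit (1 + β * b j)) (m : ℕ) :
    ((List.range m).reverse.map fun i => Aasc β n (i + 1) (b (i + 1))).prod *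
      shiftedGA β n 0 m (fun j => ominus β (b j)) = 1 := by
  induction m with
  | zero => simp [shiftedGA]
  | succ m ih =>
    have e1 : shiftedGA β n 0 (m + 1) (fun j => ominus β (b j)) =
        shiftedGA β n 0 m (fun j => ominus β (b j)) *
          Adesc β n (m + 1) (ominus β (b (m + 1))) := by
      simp [shiftedGA, List.range_succ]
    rw [prod_map_reverse_range_succ, e1, mul_assoc, ← mul_assoc _ (shiftedGA β n 0 m _), ih,
      one_mul]
    exact Aasc_mul_Adesc_ominus β n (hb _ (by omega))

theorem inverse_GA_ominus (b : ℕ → R) (hb : ∀ j, 1 ≤ j → j < n → IsUnit (1 + β * b j)) :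
    Ring.inverse (GA β n fun j => ominus β (b j)) =
      ((List.range n).reverse.map fun i => Aasc β n (i + 1) (b (i + 1))).prod := by
  have hu := isUnit_GA_ominus β n b hb
  have e := prod_Aasc_mul_shiftedGA_ominus β n b hb n
  rw [← GA_eq_shiftedGA] at e
  rw [← mul_one (List.prod _), ← Ring.mul_inverse_cancel _ hu, ← mul_assoc, e, one_mul]

/-- Each ascending product raises the shift by one and emits a row; for `m = n` the shifted factor
is trivial and only rows remain. -/
theorem prod_Aasc_mul_shiftedGA (b y : ℕ → R) (m : ℕ) :
    ((List.range m).reverse.map fun i => Aasc β n (i + 1) (b (i + 1))).prod *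
      shiftedGA β n 0 n y =
    shiftedGA β n m n y * ((List.range m).reverse.map fun i => row β n i n (b (i + 1)) y).prod := by
  induction m with
  | zero => simp
  | succ m ih =>
    rw [prod_map_reverse_range_succ, prod_map_reverse_range_succ, mul_assoc, ih, ← mul_assoc,
      Aasc_mul_shiftedGA, mul_assoc]

/-- Prepending an argument to `G_A`: this is how the `x_i` enter the sequence `p`. -/
theorem Adesc_mul_shiftedGA (t : R) (y y' : ℕ → R) (h0 : y' 1 = t)
    (hs : ∀ i, y' (i + 2) = y (i + 1)) :
    Adesc β n 1 t * shiftedGA β n 1 n y = shiftedGA β n 0 n y' := by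
  rw [← shiftedGA_of_le β n (Nat.le_succ n) (by omega) y', shiftedGA, shiftedGA,
    List.range_succ_eq_map, List.map_cons, List.prod_cons, List.map_map, h0]
  congr 3
  funext i
  rw [Function.comp_apply, ← hs]
  congr 1
  omega

/-! #### The weights -/

section Weights

variable (X : Kind) (a b x : ℕ → R)

theorem wt_first {m c : ℕ} (hm : m < n) (hc : c < m) :
    wt β n X a b x (c + 1) (2 * n - m) = oplus β (b (n - m)) (p n a x (c + 1)) := by
  have e : oplus β (p n a x (c + 1)) (q n b x (2 * n - m)) =
      oplus β (b (n - m)) (p n a x (c + 1)) := by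
    rw [q, if_neg (by omega), show 2 * n - m - n = n - m by omega]
    simp only [oplus]
    ring
  cases X with
  | B => rw [wt, if_neg (by omega), e]
  | C => rw [wt, e]

/-- The antidiagonal `i + j = n + 1` carries the letters `s_0`; there `p_i = q_j`, which gives `t ⊕
t` in type `C`. -/
theorem wt_zero {s : ℕ} (hs : s < n) :
    wt β n X a b x (s + 1) (n - s) = midArg β X (x (n - s)) := by
  have e : n + 1 - (s + 1) = n - s := by omega
  cases X with
  | B => rw [wt, if_pos (by omega), midArg, e]
  | C => rw [wt, midArg, p, if_pos (by omega), q, if_pos (by omega), e]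

/-- Dropping the first `s + 1` entries of the full sequence `p` leaves the one in which only `x_1,
..., x_{n-1-s}` have been absorbed. -/
theorem wt_succ {s i : ℕ} (hs : s < n) :
    wt β n X a b x (s + (i + 2)) (n - s) = oplus β (x (n - s)) (p (n - 1 - s) a x (i + 1)) := by
  have e : oplus β (p n a x (s + (i + 2))) (q n b x (n - s)) =
      oplus β (x (n - s)) (p (n - 1 - s) a x (i + 1)) := by
    have e' : p n a x (s + (i + 2)) = p (n - 1 - s) a x (i + 1) := by
      simp only [p]
      split_ifs
      · congr 1; omega
      · omega
      · omega
      · congr 1; omega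
    rw [q, if_pos (by omega), e']
    simp only [oplus]
    ring
  cases X with
  | B => rw [wt, if_neg (by omega), e]
  | C => rw [wt, e]

end Weights

/-! #### The factors `F^X(x_i)` -/

variable [NeZero n] (X : Kind)

theorem F_eq (t : R) :
    F β n X t = Adesc β n 1 t * fac β n 0 (midArg β X t) * Aasc β n 1 t := by
  have h0 (s : R) : fac β n 0 s = h (coxMatrix n) β 0 s := fac_eq_h β n (NeZero.pos n) s
  cases X with
  | B => rw [F, h0, midArg]
  | C => rw [F, h0, midArg, pow_two, h_mul_h]

theorem F_eq_partialF (t : R) : F β n X t = partialF β n X n t := by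
  have key (k : ℕ) : F β n X t =
      Adesc β n (k + 1) t * partialF β n X k t * Aasc β n (k + 1) t := by
    induction k with
    | zero => exact F_eq β n X t
    | succ k ih => rw [ih, Adesc_eq, Aasc_eq, partialF]; simp only [mul_assoc]
  rw [key n, Adesc_eq_one β n (by omega), Aasc_eq_one β n (by omega), mul_one, one_mul]

/-- The reversal puts `F(x_1)` next to `G_A(a)`, so that successive absorption yields `x_n, ...,
x_1, a_1, ...`, the order of `p`. -/
theorem Fprod_eq_reverse (x : ℕ → R) :
    Fprod β n X x = ((List.range n).reverse.map fun i => F β n X (x (i + 1))).prod := by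
  rw [List.map_reverse, Fprod]
  refine (List.reverse_perm _).symm.prod_eq' ?_
  rw [List.pairwise_map]
  refine List.pairwise_of_forall fun i j => ?_
  rw [F_eq_partialF, F_eq_partialF]
  exact commute_partialF β n X n _ _

/-- The factors of a row of the second part of `Δ_n^X`. -/
def rowF (a x : ℕ → R) (k : ℕ) : IdAlg (coxMatrix n) β :=
  fac β n 0 (midArg β X (x (k + 1))) * row β n 0 n (x (k + 1)) (p k a x)

/-- The ascending half raises the shift of `G_A` and leaves a row, `h_0` commutes with the shifted
product (indices at least 2), and the descending half fills the vacated first place. -/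
theorem F_mul_shiftedGA (a x : ℕ → R) (k : ℕ) :
    F β n X (x (k + 1)) * shiftedGA β n 0 n (p k a x) =
      shiftedGA β n 0 n (p (k + 1) a x) * rowF β n X a x k := by
  have hs : ∀ i, p (k + 1) a x (i + 2) = p k a x (i + 1) := by
    intro i
    simp only [p]
    split_ifs
    · congr 1; omega
    · omega
    · omega
    · congr 1; omega
  have e := Adesc_mul_shiftedGA β n (x (k + 1)) (p k a x) (p (k + 1) a x) (by simp [p]) hs
  have e2 := Aasc_mul_shiftedGA β n 0 (x (k + 1)) (p k a x)
  rw [zero_add] at e2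
  rw [F_eq, mul_assoc, e2, mul_assoc, ← mul_assoc (fac β n 0 _),
    (commute_fac_zero_shiftedGA β n le_rfl _ _).eq, ← e, rowF]
  simp only [mul_assoc]

theorem prod_F_mul_shiftedGA (a x : ℕ → R) (m : ℕ) :
    ((List.range m).reverse.map fun i => F β n X (x (i + 1))).prod * GA β n a =
      shiftedGA β n 0 n (p m a x) * ((List.range m).reverse.map (rowF β n X a x)).prod := by
  induction m with
  | zero =>
    rw [GA_eq_shiftedGA]
    simp [shiftedGA, p]
  | succ m ih =>
    rw [prod_map_reverse_range_succ, prod_map_reverse_range_succ, mul_assoc, ih, ← mul_assoc,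
      F_mul_shiftedGA, mul_assoc]

/-- The generating function is a product of rows. -/
theorem genFun_eq_prod_rows (a b x : ℕ → R)
    (hb : ∀ j, 1 ≤ j → j < n → IsUnit (1 + β * b j)) :
    genFun β n X a b x =
      ((List.range n).map fun m => row β n (n - 1 - m) n (b (n - 1 - m + 1)) (p n a x)).prod *
        ((List.range n).map fun s => rowF β n X a x (n - 1 - s)).prod := by
  rw [genFun, inverse_GA_ominus β n b hb, Fprod_eq_reverse, mul_assoc, prod_F_mul_shiftedGA,
    ← mul_assoc, prod_Aasc_mul_shiftedGA, shiftedGA_eq_one, one_mul, prod_map_reverse_range,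
    prod_map_reverse_range]

/-! #### Comparison with the cells of `Δ_n^X` -/

theorem genFun_eq_prod_cells (a b x : ℕ → R)
    (hb : ∀ j, 1 ≤ j → j < n → IsUnit (1 + β * b j)) :
    genFun β n X a b x =
      ((cells n).map fun c => h (coxMatrix n) β c.letter (wt β n X a b x c.i c.j)).prod := by
  rw [genFun_eq_prod_rows β n X a b x hb, cells, List.map_append, List.prod_append, cellsA,
    cellsBC, prod_map_flatMap, prod_map_flatMap]
  simp only [List.map_map, Function.comp_def, h_eq_fac]
  congr 1
  · rw [← prod_map_finRange]
    congr 2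
    funext m
    obtain ⟨m, hm⟩ := m
    simp only
    -- The algebraic row has `n` factors, row `m` of `Δ` only `m` letters; the excess indices are at
    -- least `n`. For `m = 0` the row is trivial, so `b_n` does not occur.
    rw [prod_map_finRange m fun c => fac β n (n - m + c) (wt β n X a b x (c + 1) (2 * n - m)), row,
      prod_map_range_eq_of_le hm.le fun i hi => fac_eq_one β n (by omega) _]
    refine congrArg List.prod (List.map_congr_left fun c hc => ?_)
    rw [wt_first β n X a b x hm (List.mem_range.1 hc), show n - 1 - m + 1 = n - m by omega,
      show n - 1 - m + c + 1 = n - m + c by omega]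
  · rw [← prod_map_finRange]
    congr 2
    funext s
    obtain ⟨s, hs⟩ := s
    simp only
    -- A trivial factor of index `n` is added to match `h_0` followed by the `n` factors of `row`.
    rw [prod_map_finRange n fun t => fac β n t (wt β n X a b x (s + (t + 1)) (n - s)),
      ← prod_map_range_eq_of_le (Nat.le_succ n) fun i hi => fac_eq_one β n hi _,
      List.range_succ_eq_map, List.map_cons, List.prod_cons, List.map_map, zero_add,
      wt_zero β n X a b x hs, rowF, row, show n - 1 - s + 1 = n - s by omega]
    congr 3
    funext i
    rw [Function.comp_apply, wt_succ β n X a b x hs, zero_add]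

theorem genFun_eq_prod_delta (a b x : ℕ → R)
    (hb : ∀ j, 1 ≤ j → j < n → IsUnit (1 + β * b j)) :
    genFun β n X a b x = ((List.finRange (delta n).length).map fun k =>
      h (coxMatrix n) β ((delta n).get k) (wtAt β n X a b x k)).prod := by
  rw [genFun_eq_prod_cells β n X a b x hb]
  refine congrArg List.prod (List.ext_getElem (by simp [delta]) fun i h1 h2 => ?_)
  simp only [delta, wtAt, cellAt, List.getElem_map, List.getElem_finRange, List.get_eq_getElem]
  rfl

end Factorization

end TypeBC

/-- Extended excited Young diagram (pipe dream) formula for the double Grothendieck polynomials of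
types `B` and `C`. The first part of the conclusion says that the generating function has unique
coefficients with respect to the `u_w`, so that `𝒢^X_{n,w}` is well defined; the second part is
the formula. -/
theorem theorem5 (X : TypeBC.Kind) (n : ℕ) [NeZero n]
    {W : Type*} [Group W] (cs : CoxeterSystem (TypeBC.coxMatrix n) W)
    {R : Type*} [CommRing R] (β : R) (a b x : ℕ → R)
    (hb : ∀ j, 1 ≤ j → j < n → IsUnit (1 + β * b j)) :
    (∃! c : W →₀ R, TypeBC.IsExpansion β cs (TypeBC.genFun β n X a b x) c) ∧
      ∀ w : W, TypeBC.groth β n cs X a b x w =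
        ∑ D ∈ TypeBC.Rsub cs (TypeBC.delta n) w, TypeBC.Wt β n X a b x cs D := by
  have hM := TypeBC.orderOf_simple_mul_simple cs
  have hM0 := TypeBC.coxMatrix_ne_zero n
  obtain ⟨c, hc⟩ := TypeBC.exists_isExpansion β cs hM hM0 (TypeBC.genFun β n X a b x)
  refine ⟨⟨c, hc, fun c' hc' => hc'.unique β cs hM hc⟩, fun w => ?_⟩
  rw [TypeBC.groth, TypeBC.genFun_eq_prod_delta β n X a b x hb,
    TypeBC.coeff_prod_h cs β (TypeBC.delta n) (TypeBC.wtAt β n X a b x) hM hM0]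
  rfl
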